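/- Let $V\colon\mathbb{R}\to\mathbb{R}$ be of class $C^{3}$, symmetric ($V(x)=V(-x)$), strictly convex, with $\liminf_{|x|\to\infty}V(x)/\log|x|>1$. For a probability measure $\rho$ on $\mathbb{R}$ let $$\mathcal{E}[\rho]=-\frac12\iint\log|x-y|\,\mathrm{d}\rho(x)\,\mathrm{d}\rho(y)+\int V(x)\,\mathrm{d}\rho(x)\in(-\infty,+\infty]$$ (with $-\log 0=+\infty$, and both terms read as the single double integral of $\tfrac12\left(-\log|x-y|+V(x)+V(y)\right)$). Let $T_n$ be the Chebyshev polynomials of the first kind, $h_0=\pi$ and $h_n=\pi/2$ for $n\ge1$, and for $R>0$ let $$c_n(R)=\frac1{h_n}\int_{-1}^{1}\frac{V(Rx)T_n(x)}{\sqrt{1-x^2}}\,\mathrm{d}x,\qquad P_R(x)=1-\sum_{n\ge1}n\,c_n(R)\,T_n(x/R)\quad(|x|\le R).$$ Then the following holds. The series $\sum_{n\ge1}n\,c_n(R)$ converges absolutely for every $R>0$, and so does the series that defines $P_R(x)$ for every $|x|\le R$. The equation $\sum_{n\geq1}n\,c_{n}(R)=1$ has a smallest positive solution $R_\star$. For $|x|<R_\star$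 the limit $Q(x)=\lim_{R\uparrow R_\star}P_R(x)/(R^2-x^2)$ exists, and $Q$ extends continuously to $[-R_\star,R_\star]$. The function $P_R$ is nonnegative on $[-R,R]$ if $0<R<R_\star$, and $Q$ is nonnegative on $[-R_\star,R_\star]$. For every $R>0$ there is exactly one minimiser $\rho_R$ of $\mathcal{E}$ among the probability measures supported in $[-R,R]$, namely $$\mathrm{d}\rho_R(x)=\begin{cases}\dfrac{1}{\pi}\dfrac{P_R(x)}{\sqrt{R^2-x^2}}\,\mathbf{1}_{|x|<R}\,\mathrm{d}x&\text{if }R<R_\star\text{ (pushed phase)},\\[2ex]\dfrac1\pi\,Q(x)\sqrt{R_\star^2-x^2}\,\mathbf{1}_{|x|\le R_\star}\,\mathrm{d}x&\text{if }R\ge R_\star\text{ (pulled phase)},\end{cases}$$ and its support is $[-R,R]$ in the pushed phase and $[-R_\star,R_\star]$ in the pulled phase. Moreover $\rho_{R_\star}$ minimises $\mathcal{E}$ among all probability measures on $\mathbb{R}$. -/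

import Mathlib

namespace LogGas

/-- The logarithmic interaction `Φ(x) = -log |x|`, with `Φ(0) = +∞`. -/
noncomputable def logInteraction (x : ℝ) : EReal :=
  if x = 0 then ⊤ else ((-Real.log |x| : ℝ) : EReal)

/-- Integral of an extended real valued function: integral of the positive part minus integral of
the negative part. It is the usual integral as soon as the negative part has a finite integral. -/
noncomputable def eintegral {α : Type*} [MeasurableSpace α] (μ : MeasureTheory.Measure α)
    (f : α → EReal) : EReal :=
  ((∫⁻ a, (f a).toENNReal ∂μ : ENNReal) : EReal) - ((∫⁻ a, (-f a).toENNReal ∂μ : ENNReal) : EReal)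

/-- The mean field energy `ℰ[ρ] = ½ ∬ Φ(x - y) dρ(x) dρ(y) + ∫ V dρ` of a probability measure `ρ`.
Both terms are put under one double integral, `∬ ½ (Φ(x - y) + V(x) + V(y)) dρ(x) dρ(y)`: this is
the same number when `ρ` is compactly supported, and it is also well defined, with values in
`(-∞, +∞]`, for every probability measure on the line when `V` grows faster than the logarithm. -/
noncomputable def energy (V : ℝ → ℝ) (ρ : MeasureTheory.Measure ℝ) : EReal :=
  eintegral (ρ.prod ρ) fun p =>
    ((1 / 2 : ℝ) : EReal) * (logInteraction (p.1 - p.2) + ((V p.1 + V p.2 : ℝ) : EReal))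

/-- The probability measures on the line that are carried by `B`
(for closed `B`: whose support lies in `B`). -/
def probOn (B : Set ℝ) : Set (MeasureTheory.Measure ℝ) :=
  {ρ | MeasureTheory.IsProbabilityMeasure ρ ∧ ρ Bᶜ = 0}

/-- `ρ` solves the minimisation problem for the energy over the probability measures on `B`. -/
def IsEquilibrium (V : ℝ → ℝ) (B : Set ℝ) (ρ : MeasureTheory.Measure ℝ) : Prop :=
  ρ ∈ probOn B ∧ IsMinOn (energy V) (probOn B) ρ

/-- The normalisation constants `h₀ = π` and `hₙ = π / 2` for `n ≥ 1`. -/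
noncomputable def chebNorm (n : ℕ) : ℝ := if n = 0 then Real.pi else Real.pi / 2

/-- The value at `x` of the Chebyshev polynomial of the first kind `Tₙ`. -/
noncomputable def chebT (n : ℕ) (x : ℝ) : ℝ := (Polynomial.Chebyshev.T ℝ (n : ℤ)).eval x

/-- The Chebyshev coefficients `cₙ(R)` of the function `x ↦ V (R x)` on `[-1, 1]`. -/
noncomputable def chebCoeff (V : ℝ → ℝ) (R : ℝ) (n : ℕ) : ℝ :=
  (1 / chebNorm n) * ∫ x in (-1 : ℝ)..1, V (R * x) * chebT n x / √(1 - x ^ 2)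

/-- `P_R(x) = 1 - ∑_{n ≥ 1} n cₙ(R) Tₙ(x / R)` (the summand for `n = 0` vanishes). -/
noncomputable def pushedP (V : ℝ → ℝ) (R x : ℝ) : ℝ :=
  1 - ∑' n : ℕ, (n : ℝ) * chebCoeff V R n * chebT n (x / R)

/-- The measure with density `P_R(x) / (π √(R² - x²))` on `|x| < R`. -/
noncomputable def pushedMeasure (V : ℝ → ℝ) (R : ℝ) : MeasureTheory.Measure ℝ :=
  MeasureTheory.volume.withDensity fun x => ENNReal.ofReal
    ((Set.Ioo (-R) R).indicator (fun x => 1 / Real.pi * (pushedP V R x / √(R ^ 2 - x ^ 2))) x)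

/-- The measure with density `Q(x) √(r² - x²) / π` on `|x| ≤ r`. -/
noncomputable def pulledMeasure (Q : ℝ → ℝ) (r : ℝ) : MeasureTheory.Measure ℝ :=
  MeasureTheory.volume.withDensity fun x => ENNReal.ofReal
    ((Set.Icc (-r) r).indicator (fun x => 1 / Real.pi * (Q x * √(r ^ 2 - x ^ 2))) x)

end LogGas

/-! Write S(R) for the mean of y V'(y) under the arcsine law on [-R, R] (`meanVirial`), and m_R(x)
for the arcsine mean of (V'(x) - V'(y)) / (x - y) (`meanSlope`). Integration by parts turns n c_n(R)
into a sine coefficient of sin θ · R V'(R cos θ), and summing the conjugate series gives P_R(x) = 1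
- S(R) + (R² - x²) m_R(x) (`hasSum_nat_mul_chebCoeff`, `pushedP_eq`). At x = R this turns the
equation for the critical radius into S(R) = 1. A root exists because S is continuous, S(0) = 0 and
convexity makes S grow at least linearly; below the smallest root r one has S < 1
(`exists_critical_radius`). Strict convexity gives m_R > 0, hence P_R > 0 for R < r, and Q = m_r.

On [-R, R] the kernel -log |x - y| is log 2 - log R + Σ (2/n) T_n(x/R) T_n(y/R), handled by Abel
summation. The measure with density P_R / (π √(R² - x²)) has moments -n c_n(R) / 2, so its potential
is a constant minus V (`potential_pushed`). By the same expansion the energy of a competitor exceeds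
that of a measure satisfying the Euler-Lagrange conditions by at least half of Σ (2/n) (difference
of moments)² (`energy_sub_ge`). Since the moments determine the measure, these conditions give the
unique minimiser (`isEquilibrium_of_potential`).

For R ≥ r the minimiser is the critical measure, and what remains is Ψ ≥ C outside [-r, r], where Ψ
is V plus its potential and C the value of Ψ on [-r, r]. To the right of r, Ψ is convex, so Ψ(r + h)
≥ C - O(h^(3/2)) is enough. This follows from a second difference at r: Ψ = C on the left, V is
convex, and the density vanishes like a square root at the edge (`effective_potential_ge`).
Minimality on all large intervals passes to the line by restricting and renormalising a competitor
(`isEquilibrium_univ`). -/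

namespace LogGas

open Real Set Filter Topology MeasureTheory

/-! ### Cosine series and conjugate series of a function of cos φ -/

section

open intervalIntegral

/-- The divided difference of a primitive of `w`, written as a mean of `w` over a segment. -/
noncomputable def divDiff (w : ℝ → ℝ) (x y : ℝ) : ℝ := ∫ t in (0 : ℝ)..1, w (y + t * (x - y))

lemma continuous_divDiff {w : ℝ → ℝ} (hw : Continuous w) :
    Continuous fun p : ℝ × ℝ => divDiff w p.1 p.2 := by
  unfold divDiff
  apply continuous_parametric_intervalIntegral_of_continuous'
  fun_prop

lemma sub_mul_divDiff {W w : ℝ → ℝ} (hW : ∀ x, HasDerivAt W (w x) x) (hw : Continuous w)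
    (x y : ℝ) : (x - y) * divDiff w x y = W x - W y := by
  have h : ∀ t ∈ uIcc (0 : ℝ) 1,
      HasDerivAt (fun t => W (y + t * (x - y))) (w (y + t * (x - y)) * (x - y)) t := by
    intro t _
    have h1 : HasDerivAt (fun t : ℝ => y + t * (x - y)) (x - y) t := by
      simpa using ((hasDerivAt_id t).mul_const (x - y)).const_add y
    exact (hW _).comp t h1
  have := integral_eq_sub_of_hasDerivAt h (by apply Continuous.intervalIntegrable; fun_prop)
  rw [intervalIntegral.integral_mul_const] at this
  rw [mul_comm, divDiff, this]
  ring_nf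

/-- Riemann-Lebesgue on `[0, π]`. -/
lemma tendsto_integral_mul_exp (h : ℝ → ℝ) :
    Tendsto (fun N : ℕ => ∫ φ in (0 : ℝ)..π, (h φ : ℂ) * Complex.exp (N * φ * Complex.I))
      atTop (𝓝 0) := by
  -- No integrability of h is needed: the integral of a nonintegrable function is 0 by convention.
  have key := Real.tendsto_integral_exp_smul_cocompact
    (fun v : ℝ => (Ioc 0 π).indicator (fun v => (h v : ℂ)) v)
  -- The Fourier character is exp(-2πi v w), so frequency N with a plus sign is w = -N / (2π).
  have h2 : Tendsto (fun N : ℕ => -((N : ℝ) / (2 * π))) atTop (cocompact ℝ) := by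
    refine Tendsto.mono_right ?_ (atBot_le_cocompact)
    rw [tendsto_neg_atBot_iff]
    exact tendsto_natCast_atTop_atTop.atTop_div_const (by positivity)
  refine (key.comp h2).congr fun N => ?_
  simp only [Function.comp_def]
  rw [intervalIntegral.integral_of_le pi_pos.le, ← MeasureTheory.integral_indicator measurableSet_Ioc]
  congr 1
  ext v
  by_cases hv : v ∈ Ioc 0 π
  · simp only [indicator_of_mem hv]
    rw [Circle.smul_def, Real.fourierChar_apply, smul_eq_mul, mul_comm]
    congr 2
    push_cast
    field_simp
  · simp [indicator_of_notMem hv]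

lemma tendsto_integral_mul_cos {h : ℝ → ℝ} (hh : Continuous h) :
    Tendsto (fun N : ℕ => ∫ φ in (0 : ℝ)..π, h φ * cos (N * φ)) atTop (𝓝 0) := by
  have := (Complex.continuous_re.tendsto 0).comp (tendsto_integral_mul_exp h)
  refine this.congr fun N => ?_
  have hi : IntervalIntegrable (fun φ : ℝ => (h φ : ℂ) * Complex.exp (N * φ * Complex.I))
      volume 0 π := Continuous.intervalIntegrable (by fun_prop) _ _
  rw [Function.comp_apply, ← Complex.reCLM_apply, ← Complex.reCLM.intervalIntegral_comp_comm hi]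
  refine intervalIntegral.integral_congr fun φ _ => ?_
  have : (N : ℂ) * φ * Complex.I = ((N * φ : ℝ) : ℂ) * Complex.I := by push_cast; ring
  simp only [this, Complex.reCLM_apply, Complex.re_ofReal_mul, Complex.exp_ofReal_mul_I_re]

lemma tendsto_integral_mul_sin {h : ℝ → ℝ} (hh : Continuous h) :
    Tendsto (fun N : ℕ => ∫ φ in (0 : ℝ)..π, h φ * sin (N * φ)) atTop (𝓝 0) := by
  have := (Complex.continuous_im.tendsto 0).comp (tendsto_integral_mul_exp h)
  refine this.congr fun N => ?_
  have hi : IntervalIntegrable (fun φ : ℝ => (h φ : ℂ) * Complex.exp (N * φ * Complex.I))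
      volume 0 π := Continuous.intervalIntegrable (by fun_prop) _ _
  rw [Function.comp_apply, ← Complex.imCLM_apply, ← Complex.imCLM.intervalIntegral_comp_comm hi]
  refine intervalIntegral.integral_congr fun φ _ => ?_
  have : (N : ℂ) * φ * Complex.I = ((N * φ : ℝ) : ℂ) * Complex.I := by push_cast; ring
  simp only [this, Complex.imCLM_apply, Complex.im_ofReal_mul, Complex.exp_ofReal_mul_I_im]

lemma integral_cos_nat_mul {n : ℕ} (hn : n ≠ 0) : ∫ φ in (0 : ℝ)..π, cos (n * φ) = 0 := by
  have : (n : ℝ) ≠ 0 := by exact_mod_cast hn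
  rw [intervalIntegral.integral_comp_mul_left _ this]
  simp

/-- Christoffel-Darboux for the Chebyshev polynomials, by the three-term recurrence. Multiplied out
in this way it needs no case cos α = cos φ. -/
lemma cos_kernel (N : ℕ) (α φ : ℝ) :
    (cos α - cos φ) * (1 + 2 * ∑ n ∈ Finset.range N, cos ((n + 1 : ℕ) * α) * cos ((n + 1 : ℕ) * φ)) =
      cos ((N + 1 : ℕ) * α) * cos (N * φ) - cos (N * α) * cos ((N + 1 : ℕ) * φ) := by
  induction N with
  | zero => simp
  | succ N ih =>
    rw [Finset.sum_range_succ, mul_add 2, ← add_assoc, mul_add, ih]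
    have e : ∀ x : ℝ, cos ((N + 1 + 1 : ℕ) * x) = 2 * cos x * cos ((N + 1 : ℕ) * x) - cos (N * x) := by
      intro x
      push_cast
      have h1 : ((N : ℝ) + 1 + 1) * x = (N + 1) * x + x := by ring
      have h2 : (N : ℝ) * x = (N + 1) * x - x := by ring
      rw [h1, h2, cos_add, cos_sub]; ring
    rw [e α, e φ]; ring

/-- The conjugate of `cos_kernel`. Unlike there, one term, sin φ, does not oscillate with N; it is
the one that survives in the limit. -/
lemma sin_kernel (N : ℕ) (α φ : ℝ) :
    (cos α - cos φ) * (2 * ∑ n ∈ Finset.range N, cos ((n + 1 : ℕ) * α) * sin ((n + 1 : ℕ) * φ)) =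
      sin φ + cos ((N + 1 : ℕ) * α) * sin (N * φ) - cos (N * α) * sin ((N + 1 : ℕ) * φ) := by
  induction N with
  | zero => simp
  | succ N ih =>
    rw [Finset.sum_range_succ, mul_add, mul_add, ih]
    have e : ∀ x : ℝ, cos ((N + 1 + 1 : ℕ) * x) = 2 * cos x * cos ((N + 1 : ℕ) * x) - cos (N * x) := by
      intro x
      push_cast
      have h1 : ((N : ℝ) + 1 + 1) * x = (N + 1) * x + x := by ring
      have h2 : (N : ℝ) * x = (N + 1) * x - x := by ring
      rw [h1, h2, cos_add, cos_sub]; ring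
    have e' : ∀ x : ℝ, sin ((N + 1 + 1 : ℕ) * x) = 2 * cos x * sin ((N + 1 : ℕ) * x) - sin (N * x) := by
      intro x
      push_cast
      have h1 : ((N : ℝ) + 1 + 1) * x = (N + 1) * x + x := by ring
      have h2 : (N : ℝ) * x = (N + 1) * x - x := by ring
      rw [h1, h2, sin_add, sin_sub]; ring
    rw [e α, e' φ]; ring

lemma tendsto_bdd_mul_zero {a b : ℕ → ℝ} (ha : ∀ n, |a n| ≤ 1) (hb : Tendsto b atTop (𝓝 0)) :
    Tendsto (fun n => a n * b n) atTop (𝓝 0) := by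
  refine squeeze_zero_norm (fun n => ?_) (by simpa using hb.norm)
  rw [norm_mul]
  exact mul_le_of_le_one_left (norm_nonneg _) (ha n)

/-- Cosine series of a function `W ∘ cos`, with `W` continuously differentiable. -/
lemma tendsto_cos_series {W w : ℝ → ℝ} (hW : ∀ x, HasDerivAt W (w x) x) (hw : Continuous w)
    (α : ℝ) :
    Tendsto (fun N => (∫ φ in (0 : ℝ)..π, W (cos φ)) + ∑ n ∈ Finset.range N,
      2 * (∫ φ in (0 : ℝ)..π, W (cos φ) * cos ((n + 1 : ℕ) * φ)) * cos ((n + 1 : ℕ) * α)) atTop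
      (𝓝 (π * W (cos α))) := by
  have hWc : Continuous W := continuous_iff_continuousAt.2 fun x => (hW x).continuousAt
  have hD : Continuous fun φ => divDiff w (cos α) (cos φ) :=
    (continuous_divDiff hw).comp (continuous_const.prodMk continuous_cos)
  have hI := tendsto_integral_mul_cos hD
  have h0 := (tendsto_bdd_mul_zero (fun n => abs_cos_le_one ((n + 1 : ℕ) * α)) hI).sub
    (tendsto_bdd_mul_zero (fun n => abs_cos_le_one (n * α)) (hI.comp (tendsto_add_atTop_nat 1)))
  have h1 := h0.const_sub (π * W (cos α))
  simp only [sub_zero] at h1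
  refine h1.congr fun N => ?_
  simp only [Function.comp_def]
  have e1 : (∫ φ in (0 : ℝ)..π, W (cos φ)) + ∑ n ∈ Finset.range N,
      2 * (∫ φ in (0 : ℝ)..π, W (cos φ) * cos ((n + 1 : ℕ) * φ)) * cos ((n + 1 : ℕ) * α) =
      ∫ φ in (0 : ℝ)..π, W (cos φ) *
        (1 + 2 * ∑ n ∈ Finset.range N, cos ((n + 1 : ℕ) * α) * cos ((n + 1 : ℕ) * φ)) := by
    have : ∀ φ, W (cos φ) *
        (1 + 2 * ∑ n ∈ Finset.range N, cos ((n + 1 : ℕ) * α) * cos ((n + 1 : ℕ) * φ)) =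
        W (cos φ) + ∑ n ∈ Finset.range N,
          2 * (W (cos φ) * cos ((n + 1 : ℕ) * φ)) * cos ((n + 1 : ℕ) * α) := by
      intro φ
      rw [mul_add, mul_one, Finset.mul_sum, Finset.mul_sum]
      congr 1
      exact Finset.sum_congr rfl fun n _ => by ring
    simp_rw [this]
    rw [intervalIntegral.integral_add (Continuous.intervalIntegrable (by fun_prop) _ _)
      (Continuous.intervalIntegrable (by fun_prop) _ _),
      intervalIntegral.integral_finsetSum
        fun n _ => (Continuous.intervalIntegrable (by fun_prop) _ _)]
    simp
  have e2 : ∫ φ in (0 : ℝ)..π,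
      (1 + 2 * ∑ n ∈ Finset.range N, cos ((n + 1 : ℕ) * α) * cos ((n + 1 : ℕ) * φ)) = π := by
    rw [intervalIntegral.integral_add (Continuous.intervalIntegrable (by fun_prop) _ _)
      (Continuous.intervalIntegrable (by fun_prop) _ _), intervalIntegral.integral_const_mul,
      intervalIntegral.integral_finsetSum
        fun n _ => (Continuous.intervalIntegrable (by fun_prop) _ _)]
    simp_rw [intervalIntegral.integral_const_mul, integral_cos_nat_mul (Nat.succ_ne_zero _)]
    simp
  -- W(cos φ) = W(cos α) - (cos α - cos φ) · divided difference. The factor cos α - cos φ is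
  -- absorbed by the kernel, which leaves oscillating integrals with a continuous amplitude, to be
  -- killed by Riemann-Lebesgue.
  have e3 : ∀ φ, W (cos φ) *
      (1 + 2 * ∑ n ∈ Finset.range N, cos ((n + 1 : ℕ) * α) * cos ((n + 1 : ℕ) * φ)) =
      (1 + 2 * ∑ n ∈ Finset.range N, cos ((n + 1 : ℕ) * α) * cos ((n + 1 : ℕ) * φ)) * W (cos α) -
      (cos ((N + 1 : ℕ) * α) * (divDiff w (cos α) (cos φ) * cos (N * φ)) -
        cos (N * α) * (divDiff w (cos α) (cos φ) * cos ((N + 1 : ℕ) * φ))) := by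
    intro φ
    have := cos_kernel N α φ
    have h2 := sub_mul_divDiff hW hw (cos α) (cos φ)
    linear_combination (-divDiff w (cos α) (cos φ)) * this +
      (1 + 2 * ∑ n ∈ Finset.range N, cos ((n + 1 : ℕ) * α) * cos ((n + 1 : ℕ) * φ)) * h2
  rw [e1, intervalIntegral.integral_congr (fun φ _ => e3 φ),
    intervalIntegral.integral_sub (Continuous.intervalIntegrable (by fun_prop) _ _)
      (Continuous.intervalIntegrable (by fun_prop) _ _), intervalIntegral.integral_mul_const, e2,
    intervalIntegral.integral_sub (Continuous.intervalIntegrable (by fun_prop) _ _)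
      (Continuous.intervalIntegrable (by fun_prop) _ _)]
  simp only [intervalIntegral.integral_const_mul]

lemma integral_sin_mul_sin_nat (n : ℕ) :
    ∫ φ in (0 : ℝ)..π, sin φ * sin ((n + 1 : ℕ) * φ) = if n = 0 then π / 2 else 0 := by
  have : ∀ φ : ℝ, sin φ * sin ((n + 1 : ℕ) * φ) = 1 / 2 * cos (n * φ) - 1 / 2 * cos ((n + 2 : ℕ) * φ) := by
    intro φ
    push_cast
    have h1 : (n : ℝ) * φ = (n + 1) * φ - φ := by ring
    have h2 : ((n : ℝ) + 2) * φ = (n + 1) * φ + φ := by ring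
    rw [h1, h2, cos_add, cos_sub]; ring
  simp_rw [this]
  rw [intervalIntegral.integral_sub (Continuous.intervalIntegrable (by fun_prop) _ _)
      (Continuous.intervalIntegrable (by fun_prop) _ _), intervalIntegral.integral_const_mul,
      intervalIntegral.integral_const_mul, integral_cos_nat_mul (Nat.succ_ne_zero _)]
  split_ifs with h
  · subst h; simp; ring
  · rw [integral_cos_nat_mul h]; simp

/-- The conjugate series. -/
lemma tendsto_conj_series {W w : ℝ → ℝ} (hW : ∀ x, HasDerivAt W (w x) x) (hw : Continuous w)
    (α : ℝ) :
    Tendsto (fun N => ∑ n ∈ Finset.range N,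
      2 * (∫ φ in (0 : ℝ)..π, sin φ * W (cos φ) * sin ((n + 1 : ℕ) * φ)) * cos ((n + 1 : ℕ) * α))
      atTop (𝓝 (π * (cos α * W (cos α)) -
        ∫ φ in (0 : ℝ)..π, sin φ ^ 2 * divDiff w (cos α) (cos φ))) := by
  have hWc : Continuous W := continuous_iff_continuousAt.2 fun x => (hW x).continuousAt
  have hD0 : Continuous fun φ => divDiff w (cos α) (cos φ) :=
    (continuous_divDiff hw).comp (continuous_const.prodMk continuous_cos)
  have hD : Continuous fun φ => sin φ * divDiff w (cos α) (cos φ) := by fun_prop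
  have hI := tendsto_integral_mul_sin hD
  have h0 := (tendsto_bdd_mul_zero (fun n => abs_cos_le_one ((n + 1 : ℕ) * α)) hI).sub
    (tendsto_bdd_mul_zero (fun n => abs_cos_le_one (n * α)) (hI.comp (tendsto_add_atTop_nat 1)))
  have h1 := h0.const_sub (π * (cos α * W (cos α)) -
        ∫ φ in (0 : ℝ)..π, sin φ ^ 2 * divDiff w (cos α) (cos φ))
  simp only [sub_zero] at h1
  refine h1.congr' ?_
  -- In `e2` only frequency 1 is not orthogonal to sin φ, so the sum must contain at least one term.
  filter_upwards [eventually_ge_atTop 1] with N hN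
  simp only [Function.comp_def]
  have e1 : ∑ n ∈ Finset.range N,
      2 * (∫ φ in (0 : ℝ)..π, sin φ * W (cos φ) * sin ((n + 1 : ℕ) * φ)) * cos ((n + 1 : ℕ) * α) =
      ∫ φ in (0 : ℝ)..π, sin φ * W (cos φ) *
        (2 * ∑ n ∈ Finset.range N, cos ((n + 1 : ℕ) * α) * sin ((n + 1 : ℕ) * φ)) := by
    have : ∀ φ, sin φ * W (cos φ) *
        (2 * ∑ n ∈ Finset.range N, cos ((n + 1 : ℕ) * α) * sin ((n + 1 : ℕ) * φ)) =
        ∑ n ∈ Finset.range N,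
          2 * (sin φ * W (cos φ) * sin ((n + 1 : ℕ) * φ)) * cos ((n + 1 : ℕ) * α) := by
      intro φ
      rw [Finset.mul_sum, Finset.mul_sum]
      exact Finset.sum_congr rfl fun n _ => by ring
    simp_rw [this]
    rw [intervalIntegral.integral_finsetSum
        fun n _ => (Continuous.intervalIntegrable (by fun_prop) _ _)]
    simp
  have e2 : ∫ φ in (0 : ℝ)..π,
      sin φ * (2 * ∑ n ∈ Finset.range N, cos ((n + 1 : ℕ) * α) * sin ((n + 1 : ℕ) * φ)) =
      π * cos α := by
    have : ∀ φ, sin φ *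
        (2 * ∑ n ∈ Finset.range N, cos ((n + 1 : ℕ) * α) * sin ((n + 1 : ℕ) * φ)) =
        ∑ n ∈ Finset.range N,
          2 * cos ((n + 1 : ℕ) * α) * (sin φ * sin ((n + 1 : ℕ) * φ)) := by
      intro φ
      rw [Finset.mul_sum, Finset.mul_sum]
      exact Finset.sum_congr rfl fun n _ => by ring
    simp_rw [this]
    rw [intervalIntegral.integral_finsetSum
        fun n _ => (Continuous.intervalIntegrable (by fun_prop) _ _)]
    simp_rw [intervalIntegral.integral_const_mul, integral_sin_mul_sin_nat]
    rw [Finset.sum_eq_single_of_mem 0 (Finset.mem_range.2 hN) (by intro b _ hb; simp [hb])]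
    simp; ring
  have e3 : ∀ φ, sin φ * W (cos φ) *
      (2 * ∑ n ∈ Finset.range N, cos ((n + 1 : ℕ) * α) * sin ((n + 1 : ℕ) * φ)) =
      sin φ * (2 * ∑ n ∈ Finset.range N, cos ((n + 1 : ℕ) * α) * sin ((n + 1 : ℕ) * φ)) * W (cos α) -
      sin φ ^ 2 * divDiff w (cos α) (cos φ) -
      (cos ((N + 1 : ℕ) * α) * (sin φ * divDiff w (cos α) (cos φ) * sin (N * φ)) -
        cos (N * α) * (sin φ * divDiff w (cos α) (cos φ) * sin ((N + 1 : ℕ) * φ))) := by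
    intro φ
    have := sin_kernel N α φ
    have h2 := sub_mul_divDiff hW hw (cos α) (cos φ)
    linear_combination (-sin φ * divDiff w (cos α) (cos φ)) * this +
      sin φ * (2 * ∑ n ∈ Finset.range N, cos ((n + 1 : ℕ) * α) * sin ((n + 1 : ℕ) * φ)) * h2
  rw [e1, intervalIntegral.integral_congr (fun φ _ => e3 φ),
    intervalIntegral.integral_sub (Continuous.intervalIntegrable (by fun_prop) _ _)
      (Continuous.intervalIntegrable (by fun_prop) _ _),
    intervalIntegral.integral_sub (Continuous.intervalIntegrable (by fun_prop) _ _)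
      (Continuous.intervalIntegrable (by fun_prop) _ _), intervalIntegral.integral_mul_const, e2,
    intervalIntegral.integral_sub (Continuous.intervalIntegrable (by fun_prop) _ _)
      (Continuous.intervalIntegrable (by fun_prop) _ _)]
  simp only [intervalIntegral.integral_const_mul]
  ring

/-! ### Chebyshev coefficients of the potential -/

lemma chebT_cos (n : ℕ) (θ : ℝ) : chebT n (cos θ) = cos (n * θ) := by
  simp [chebT, Polynomial.Chebyshev.T_real_cos]

lemma chebT_div_eq {R x : ℝ} (hR : 0 < R) (hx : x ∈ Icc (-R) R) (n : ℕ) :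
    chebT n (x / R) = cos (n * arccos (x / R)) := by
  rw [← chebT_cos, cos_arccos]
  · rw [le_div_iff₀ hR]; linarith [hx.1]
  · rw [div_le_iff₀ hR]; linarith [hx.2]

lemma mul_cos_arccos_div {R x : ℝ} (hR : 0 < R) (hx : x ∈ Icc (-R) R) :
    R * cos (arccos (x / R)) = x := by
  rw [cos_arccos]
  · field_simp
  · rw [le_div_iff₀ hR]; linarith [hx.1]
  · rw [div_le_iff₀ hR]; linarith [hx.2]

lemma abs_chebT_div_le_one {R x : ℝ} (hR : 0 < R) (hx : x ∈ Icc (-R) R) (n : ℕ) :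
    |chebT n (x / R)| ≤ 1 := by
  rw [chebT_div_eq hR hx]
  exact abs_cos_le_one _

@[fun_prop]
lemma continuous_chebT (n : ℕ) : Continuous (chebT n) :=
  (Polynomial.Chebyshev.T ℝ (n : ℤ)).continuous

lemma chebCoeff_eq_integral_cos (V : ℝ → ℝ) (R : ℝ) (n : ℕ) :
    chebCoeff V R n = 1 / chebNorm n * ∫ θ in (0 : ℝ)..π, V (R * cos θ) * cos (n * θ) := by
  have h := Polynomial.Chebyshev.integral_measureT (fun x => V (R * x) * chebT n x)
  rw [Polynomial.Chebyshev.integral_measureT_eq_integral_cos] at h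
  simp only [chebT_cos] at h
  rw [h, chebCoeff]
  congr 1
  refine intervalIntegral.integral_congr fun x _ => ?_
  simp [div_eq_mul_inv]

lemma nat_mul_integral_cos {F F' : ℝ → ℝ} (hF : ∀ x, HasDerivAt F (F' x) x) (hF' : Continuous F')
    (n : ℕ) : (n : ℝ) * ∫ φ in (0 : ℝ)..π, F φ * cos (n * φ) =
      -∫ φ in (0 : ℝ)..π, F' φ * sin (n * φ) := by
  have hd : ∀ x : ℝ, HasDerivAt (fun φ : ℝ => sin (n * φ)) (n * cos (n * x)) x := by
    intro x
    have h1 : HasDerivAt (fun φ : ℝ => (n : ℝ) * φ) n x := by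
      simpa using (hasDerivAt_id x).const_mul (n : ℝ)
    simpa [mul_comm] using h1.sin
  have := integral_mul_deriv_eq_deriv_mul (a := 0) (b := π) (fun x _ => hF x) (fun x _ => hd x)
    (hF'.intervalIntegrable _ _) (Continuous.intervalIntegrable (by fun_prop) _ _)
  simp only [sin_nat_mul_pi, mul_zero, sin_zero, sub_zero, zero_sub] at this
  rw [← this, ← intervalIntegral.integral_const_mul]
  refine intervalIntegral.integral_congr fun φ _ => ?_
  ring

lemma nat_mul_integral_sin {F F' : ℝ → ℝ} (hF : ∀ x, HasDerivAt F (F' x) x) (hF' : Continuous F')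
    (h0 : F 0 = 0) (hπ : F π = 0) (n : ℕ) : (n : ℝ) * ∫ φ in (0 : ℝ)..π, F φ * sin (n * φ) =
      ∫ φ in (0 : ℝ)..π, F' φ * cos (n * φ) := by
  have hd : ∀ x : ℝ, HasDerivAt (fun φ : ℝ => -cos (n * φ)) (n * sin (n * x)) x := by
    intro x
    have h1 : HasDerivAt (fun φ : ℝ => (n : ℝ) * φ) n x := by
      simpa using (hasDerivAt_id x).const_mul (n : ℝ)
    have h2 := h1.cos.neg
    rw [show -(-sin (n * x) * n) = n * sin (n * x) by ring] at h2
    exact h2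
  have := integral_mul_deriv_eq_deriv_mul (a := 0) (b := π) (fun x _ => hF x) (fun x _ => hd x)
    (hF'.intervalIntegrable _ _) (Continuous.intervalIntegrable (by fun_prop) _ _)
  simp only [h0, hπ, zero_mul, mul_neg, intervalIntegral.integral_neg, sub_neg_eq_add, neg_zero,
    sub_zero, zero_add] at this
  rw [← this, ← intervalIntegral.integral_const_mul]
  refine intervalIntegral.integral_congr fun φ _ => ?_
  ring

lemma hasDerivAt_of_contDiff_succ {f : ℝ → ℝ} {n : ℕ} (hf : ContDiff ℝ (n + 1 : ℕ) f) (x : ℝ) :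
    HasDerivAt f (deriv f x) x :=
  ((hf.differentiable (by norm_cast)) x).hasDerivAt

lemma contDiff_deriv_of_succ {f : ℝ → ℝ} {n : ℕ} (hf : ContDiff ℝ (n + 1 : ℕ) f) :
    ContDiff ℝ n (deriv f) :=
  ((contDiff_succ_iff_deriv (n := n)).1 (by exact_mod_cast hf)).2.2

lemma deriv_comp_mul_cos {V : ℝ → ℝ} (hV : Differentiable ℝ V) (R φ : ℝ) :
    HasDerivAt (fun φ => V (R * cos φ)) (-(R * sin φ * deriv V (R * cos φ))) φ := by
  have h1 : HasDerivAt (fun φ => R * cos φ) (R * -sin φ) φ := (hasDerivAt_cos φ).const_mul R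
  have := (hV (R * cos φ)).hasDerivAt.comp φ h1
  exact this.congr_deriv (by ring)

/-- Brings n c_n(R) into the form of the conjugate series with W(y) = R V'(R y). -/
lemma nat_mul_integral_comp_cos {V : ℝ → ℝ} (hV : ContDiff ℝ 1 V) (R : ℝ) (n : ℕ) :
    (n : ℝ) * ∫ θ in (0 : ℝ)..π, V (R * cos θ) * cos (n * θ) =
      ∫ θ in (0 : ℝ)..π, sin θ * (R * deriv V (R * cos θ)) * sin (n * θ) := by
  have hc : Continuous (deriv V) := hV.continuous_deriv le_rfl
  rw [nat_mul_integral_cos (fun x => deriv_comp_mul_cos (hV.differentiable one_ne_zero) R x)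
    (by fun_prop), ← intervalIntegral.integral_neg]
  refine intervalIntegral.integral_congr fun φ _ => ?_
  ring

/-- Three integrations by parts. In the first and the third the boundary terms contain sin(nφ); in
the second they vanish because the derivative of V(R cos φ) has a factor sin φ. Hence c_n = O(n⁻³),
which makes Σ n c_n absolutely convergent. -/
lemma exists_nat_pow_three_mul_integral_le {V : ℝ → ℝ} (hV : ContDiff ℝ 3 V) (R : ℝ) :
    ∃ M : ℝ, ∀ n : ℕ, |(n : ℝ) ^ 3 * ∫ θ in (0 : ℝ)..π, V (R * cos θ) * cos (n * θ)| ≤ M := by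
  set f : ℝ → ℝ := fun φ => V (R * cos φ) with hf
  have h3 : ContDiff ℝ (2 + 1 : ℕ) f := by
    have : ContDiff ℝ 3 f := hV.comp (contDiff_const.mul contDiff_cos)
    exact_mod_cast this
  have h2 : ContDiff ℝ (1 + 1 : ℕ) (deriv f) := contDiff_deriv_of_succ h3
  have h1 : ContDiff ℝ (0 + 1 : ℕ) (deriv (deriv f)) := contDiff_deriv_of_succ h2
  have h0 : Continuous (deriv (deriv (deriv f))) := (contDiff_deriv_of_succ h1).continuous
  have hd : deriv f = fun φ => -(R * sin φ * deriv V (R * cos φ)) :=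
    funext fun φ => (deriv_comp_mul_cos (hV.differentiable (by norm_num)) R φ).deriv
  refine ⟨∫ φ in (0 : ℝ)..π, |deriv (deriv (deriv f)) φ|, fun n => ?_⟩
  have e1 := nat_mul_integral_cos (hasDerivAt_of_contDiff_succ h3) h2.continuous n
  have e2 := nat_mul_integral_sin (hasDerivAt_of_contDiff_succ h2) h1.continuous
    (by simp [hd]) (by simp [hd]) n
  have e3 := nat_mul_integral_cos (hasDerivAt_of_contDiff_succ h1) h0 n
  have : (n : ℝ) ^ 3 * ∫ θ in (0 : ℝ)..π, f θ * cos (n * θ) =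
      ∫ φ in (0 : ℝ)..π, deriv (deriv (deriv f)) φ * sin (n * φ) := by
    linear_combination (n : ℝ) ^ 2 * e1 - (n : ℝ) * e2 - e3
  rw [this]
  refine (intervalIntegral.abs_integral_le_integral_abs pi_pos.le).trans ?_
  refine intervalIntegral.integral_mono_on pi_pos.le
    (Continuous.intervalIntegrable (by fun_prop) _ _)
    (Continuous.intervalIntegrable (by fun_prop) _ _) fun x _ => ?_
  rw [abs_mul]
  exact mul_le_of_le_one_right (abs_nonneg _) (abs_sin_le_one _)

lemma exists_nat_mul_chebCoeff_le {V : ℝ → ℝ} (hV : ContDiff ℝ 3 V) (R : ℝ) :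
    ∃ M : ℝ, ∀ n : ℕ, |(n : ℝ) * chebCoeff V R n| ≤ M * (1 / (n : ℝ) ^ 2) := by
  obtain ⟨M, hM⟩ := exists_nat_pow_three_mul_integral_le hV R
  refine ⟨2 / π * M, fun n => ?_⟩
  rcases Nat.eq_zero_or_pos n with rfl | hn
  · simp
  have hn' : (0 : ℝ) < n := by exact_mod_cast hn
  have h := hM n
  rw [chebCoeff_eq_integral_cos, chebNorm, if_neg hn.ne']
  set I := ∫ θ in (0 : ℝ)..π, V (R * cos θ) * cos (n * θ)
  have e : (n : ℝ) * (1 / (π / 2) * I) = 2 / π * ((n : ℝ) ^ 3 * I) * (1 / (n : ℝ) ^ 2) := by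
    field_simp
  rw [e, abs_mul, abs_mul, abs_of_pos (show (0 : ℝ) < 2 / π by positivity),
    abs_of_pos (show (0 : ℝ) < 1 / (n : ℝ) ^ 2 by positivity)]
  gcongr

lemma summable_abs_nat_mul_chebCoeff {V : ℝ → ℝ} (hV : ContDiff ℝ 3 V) (R : ℝ) :
    Summable fun n : ℕ => |(n : ℝ) * chebCoeff V R n| := by
  obtain ⟨M, hM⟩ := exists_nat_mul_chebCoeff_le hV R
  exact Summable.of_nonneg_of_le (fun _ => abs_nonneg _) hM
    ((Real.summable_one_div_nat_pow.2 one_lt_two).mul_left M)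

lemma summable_abs_chebCoeff {V : ℝ → ℝ} (hV : ContDiff ℝ 3 V) (R : ℝ) :
    Summable fun n : ℕ => |chebCoeff V R n| := by
  -- The comparison |c_n| ≤ |n c_n| fails at n = 0.
  rw [← summable_nat_add_iff 1]
  refine Summable.of_nonneg_of_le (fun _ => abs_nonneg _) (fun n => ?_)
    ((summable_nat_add_iff 1).2 (summable_abs_nat_mul_chebCoeff hV R))
  rw [abs_mul]
  refine le_mul_of_one_le_left (abs_nonneg _) ?_
  rw [Nat.abs_cast]
  exact_mod_cast Nat.succ_le_succ (Nat.zero_le n)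

lemma summable_mul_of_abs_le_one {a b : ℕ → ℝ} (ha : Summable fun n => |a n|)
    (hb : ∀ n, |b n| ≤ 1) : Summable fun n => a n * b n := by
  refine Summable.of_norm_bounded ha fun n => ?_
  rw [norm_mul]
  exact mul_le_of_le_one_right (norm_nonneg _) (hb n)

/-- A `C³` function is the sum of its Chebyshev series. -/
lemma hasSum_chebCoeff {V : ℝ → ℝ} (hV : ContDiff ℝ 3 V) {R x : ℝ} (hR : 0 < R)
    (hx : x ∈ Icc (-R) R) :
    HasSum (fun n : ℕ => chebCoeff V R n * chebT n (x / R)) (V x) := by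
  have hs : Summable fun n : ℕ => chebCoeff V R n * chebT n (x / R) :=
    summable_mul_of_abs_le_one (summable_abs_chebCoeff hV R) fun n => abs_chebT_div_le_one hR hx n
  have hd : ∀ y, HasDerivAt (fun y => V (R * y)) (R * deriv V (R * y)) y := by
    intro y
    have h1 : HasDerivAt (fun y => R * y) R y := by simpa using (hasDerivAt_id y).const_mul R
    have := ((hV.differentiable (by norm_num)) (R * y)).hasDerivAt.comp y h1
    rwa [mul_comm] at this
  have hc : Continuous (deriv V) := hV.continuous_deriv (by norm_num)
  have ht := (tendsto_cos_series hd (by fun_prop) (arccos (x / R))).const_mul (1 / π)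
  rw [mul_cos_arccos_div hR hx, one_div, inv_mul_cancel_left₀ pi_ne_zero] at ht
  have h2 := hs.hasSum.tendsto_sum_nat.comp (tendsto_add_atTop_nat 1)
  have := tendsto_nhds_unique ht (h2.congr fun N => ?_)
  · rw [this]; exact hs.hasSum
  · simp only [Function.comp_apply]
    -- The term n = 0 is split off because its normalisation is π and not π / 2.
    rw [Finset.sum_range_succ', mul_add, Finset.mul_sum, add_comm]
    congr 1
    · simp [chebCoeff_eq_integral_cos, chebNorm, chebT]
    · refine Finset.sum_congr rfl fun n _ => ?_
      rw [chebT_div_eq hR hx, chebCoeff_eq_integral_cos, chebNorm, if_neg (Nat.succ_ne_zero n)]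
      field_simp

/-! ### Closed form of P_R -/

/-- The mean of `y V'(y)` for the arcsine law on `[-R, R]`. -/
noncomputable def meanVirial (V : ℝ → ℝ) (R : ℝ) : ℝ :=
  1 / π * ∫ φ in (0 : ℝ)..π, R * cos φ * deriv V (R * cos φ)

/-- The mean of the divided difference `(V'(x) - V'(y)) / (x - y)` for the arcsine law on
`[-R, R]`. -/
noncomputable def meanSlope (V : ℝ → ℝ) (R x : ℝ) : ℝ :=
  1 / π * ∫ φ in (0 : ℝ)..π, divDiff (deriv (deriv V)) x (R * cos φ)

lemma integral_comp_cos_eq_zero_of_odd {g : ℝ → ℝ} (hg : ∀ x, g (-x) = -g x) :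
    ∫ φ in (0 : ℝ)..π, g (cos φ) = 0 := by
  have h := intervalIntegral.integral_comp_sub_left (a := 0) (b := π) (fun φ => g (cos φ)) π
  simp only [cos_pi_sub, hg, sub_self, sub_zero, intervalIntegral.integral_neg] at h
  linarith

lemma deriv_neg_of_even {V : ℝ → ℝ} (hsymm : ∀ x, V (-x) = V x) (x : ℝ) :
    deriv V (-x) = -deriv V x := by
  have : deriv (fun y => V (-y)) x = -deriv V (-x) := deriv_comp_neg V x
  rw [show (fun y => V (-y)) = V from funext hsymm] at this
  linarith

lemma deriv_facts {V : ℝ → ℝ} (hV : ContDiff ℝ 3 V) :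
    Continuous (deriv V) ∧ (∀ x, HasDerivAt (deriv V) (deriv (deriv V) x) x) ∧
      Continuous (deriv (deriv V)) := by
  have h3 : ContDiff ℝ (2 + 1 : ℕ) V := by exact_mod_cast hV
  have h2 : ContDiff ℝ (1 + 1 : ℕ) (deriv V) := contDiff_deriv_of_succ h3
  exact ⟨h2.continuous, hasDerivAt_of_contDiff_succ h2, (contDiff_deriv_of_succ h2).continuous⟩

/-- Closed form of the conjugate Chebyshev series of an even potential. -/
lemma hasSum_nat_mul_chebCoeff {V : ℝ → ℝ} (hV : ContDiff ℝ 3 V) (hsymm : ∀ x, V (-x) = V x)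
    {R x : ℝ} (hR : 0 < R) (hx : x ∈ Icc (-R) R) :
    HasSum (fun n : ℕ => (n : ℝ) * chebCoeff V R n * chebT n (x / R))
      (meanVirial V R - (R ^ 2 - x ^ 2) * meanSlope V R x) := by
  have hs : Summable fun n : ℕ => (n : ℝ) * chebCoeff V R n * chebT n (x / R) :=
    summable_mul_of_abs_le_one (summable_abs_nat_mul_chebCoeff hV R)
      fun n => abs_chebT_div_le_one hR hx n
  obtain ⟨hc1, hd1, hc2⟩ := deriv_facts hV
  have hd : ∀ y, HasDerivAt (fun y => R * deriv V (R * y)) (R * (R * deriv (deriv V) (R * y))) y := by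
    intro y
    have h1 : HasDerivAt (fun y => R * y) R y := by simpa using (hasDerivAt_id y).const_mul R
    have := ((hd1 (R * y)).comp y h1).const_mul R
    rwa [mul_comm (deriv (deriv V) (R * y))] at this
  set α := arccos (x / R) with hα
  have hxα : R * cos α = x := mul_cos_arccos_div hR hx
  have ht := (tendsto_conj_series hd (by fun_prop) α).const_mul (1 / π)
  have h2 := hs.hasSum.tendsto_sum_nat.comp (tendsto_add_atTop_nat 1)
  have key := tendsto_nhds_unique ht (h2.congr fun N => ?_)
  swap
  · simp only [Function.comp_apply]
    rw [Finset.sum_range_succ', Finset.mul_sum]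
    simp only [Nat.cast_zero, zero_mul, add_zero]
    refine Finset.sum_congr rfl fun n _ => ?_
    rw [chebT_div_eq hR hx, chebCoeff_eq_integral_cos, chebNorm, if_neg (Nat.succ_ne_zero n),
      ← nat_mul_integral_comp_cos (hV.of_le (by norm_num)) R (n + 1), ← hα]
    field_simp
  have hD : ∀ y, divDiff (fun y => R * (R * deriv (deriv V) (R * y))) (cos α) y =
      R ^ 2 * divDiff (deriv (deriv V)) x (R * y) := by
    intro y
    rw [divDiff, divDiff, ← intervalIntegral.integral_const_mul, ← hxα]
    refine intervalIntegral.integral_congr fun t _ => ?_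
    ring_nf
  simp only [hD] at key
  have hDc : Continuous fun φ => divDiff (deriv (deriv V)) x (R * cos φ) :=
    (continuous_divDiff hc2).comp (continuous_const.prodMk (by fun_prop))
  -- With y = R cos φ: R² sin² φ = R² - y² = (R² - x²) + (x² - y²), and (x² - y²) times the divided
  -- difference is (x + y) (V'(x) - V'(y)). Of its four terms, y V'(x) and x V'(y) are odd in y and
  -- integrate to zero.
  have hsplit : ∀ φ : ℝ, sin φ ^ 2 * (R ^ 2 * divDiff (deriv (deriv V)) x (R * cos φ)) =
      (R ^ 2 - x ^ 2) * divDiff (deriv (deriv V)) x (R * cos φ) +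
        (x * deriv V x + deriv V x * R * cos φ - x * deriv V (R * cos φ) -
          R * cos φ * deriv V (R * cos φ)) := by
    intro φ
    have := sub_mul_divDiff hd1 hc2 x (R * cos φ)
    have h3 := sin_sq_add_cos_sq φ
    linear_combination (x + R * cos φ) * this + R ^ 2 * divDiff (deriv (deriv V)) x (R * cos φ) * h3
  have hodd1 : ∫ φ in (0 : ℝ)..π, deriv V (R * cos φ) = 0 :=
    integral_comp_cos_eq_zero_of_odd (g := fun y => deriv V (R * y)) fun y => by
      rw [← deriv_neg_of_even hsymm, mul_neg]
  have hint : ∫ φ in (0 : ℝ)..π, sin φ ^ 2 * (R ^ 2 * divDiff (deriv (deriv V)) x (R * cos φ)) =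
      (R ^ 2 - x ^ 2) * (π * meanSlope V R x) + π * (x * deriv V x) - π * meanVirial V R := by
    simp_rw [hsplit]
    rw [intervalIntegral.integral_add (Continuous.intervalIntegrable (by fun_prop) _ _)
        (Continuous.intervalIntegrable (by fun_prop) _ _),
      intervalIntegral.integral_sub (Continuous.intervalIntegrable (by fun_prop) _ _)
        (Continuous.intervalIntegrable (by fun_prop) _ _),
      intervalIntegral.integral_sub (Continuous.intervalIntegrable (by fun_prop) _ _)
        (Continuous.intervalIntegrable (by fun_prop) _ _),
      intervalIntegral.integral_add (Continuous.intervalIntegrable (by fun_prop) _ _)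
        (Continuous.intervalIntegrable (by fun_prop) _ _)]
    simp only [intervalIntegral.integral_const_mul, hodd1, meanSlope, meanVirial]
    rw [integral_cos]
    simp
    field_simp
    ring
  have hval : 1 / π * (π * (cos α * (R * deriv V (R * cos α))) -
      ∫ φ in (0 : ℝ)..π, sin φ ^ 2 * (R ^ 2 * divDiff (deriv (deriv V)) x (R * cos φ))) =
      meanVirial V R - (R ^ 2 - x ^ 2) * meanSlope V R x := by
    rw [hint, hxα, ← hxα]
    field_simp
    ring
  rw [← hval, key]
  exact hs.hasSum

lemma pushedP_eq {V : ℝ → ℝ} (hV : ContDiff ℝ 3 V) (hsymm : ∀ x, V (-x) = V x)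
    {R x : ℝ} (hR : 0 < R) (hx : x ∈ Icc (-R) R) :
    pushedP V R x = 1 - meanVirial V R + (R ^ 2 - x ^ 2) * meanSlope V R x := by
  rw [pushedP, (hasSum_nat_mul_chebCoeff hV hsymm hR hx).tsum_eq]
  ring

/-- The case x = R, where T_n(1) = 1 and R² - x² = 0. It translates the equation for the critical
radius into one for `meanVirial`. -/
lemma hasSum_nat_mul_chebCoeff_one {V : ℝ → ℝ} (hV : ContDiff ℝ 3 V) (hsymm : ∀ x, V (-x) = V x)
    {R : ℝ} (hR : 0 < R) :
    HasSum (fun n : ℕ => (n : ℝ) * chebCoeff V R n) (meanVirial V R) := by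
  have := hasSum_nat_mul_chebCoeff hV hsymm hR (x := R) ⟨by linarith, le_rfl⟩
  simpa [div_self hR.ne', chebT] using this

end

/-! ### Abel summation of the logarithmic kernel -/

lemma integrable_of_continuousOn_of_compl_null {X : Type*} [TopologicalSpace X] [T2Space X]
    [MeasurableSpace X] [OpensMeasurableSpace X]
    {μ : Measure X} [IsFiniteMeasure μ] {K : Set X} (hK : IsCompact K) (hμ : μ Kᶜ = 0)
    {f : X → ℝ} (hf : ContinuousOn f K) : Integrable f μ := by
  have : μ.restrict K = μ := Measure.restrict_eq_self_of_ae_mem (mem_ae_iff.2 hμ)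
  rw [← this]
  exact hf.integrableOn_compact' hK hK.measurableSet

/-- Real part of the Taylor series of -log(1 - z) at z = r exp(iθ). -/
lemma hasSum_pow_mul_cos_div {r : ℝ} (h0 : 0 ≤ r) (h1 : r < 1) (θ : ℝ) :
    HasSum (fun n : ℕ => r ^ n * cos (n * θ) / n) (-(1 / 2 * log (1 - 2 * r * cos θ + r ^ 2))) := by
  set z : ℂ := r * Complex.exp (θ * Complex.I) with hz
  have hn : ‖z‖ < 1 := by
    rw [hz, norm_mul, Complex.norm_exp_ofReal_mul_I, mul_one, Complex.norm_real, norm_of_nonneg h0]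
    exact h1
  have h := Complex.hasSum_re (Complex.hasSum_taylorSeries_neg_log hn)
  convert h using 1
  · ext n
    have : z ^ n / n = ((r ^ n / n : ℝ) : ℂ) * Complex.exp ((n * θ : ℝ) * Complex.I) := by
      rw [hz, mul_pow, ← Complex.exp_nat_mul]
      push_cast
      ring_nf
    rw [this, Complex.re_ofReal_mul, Complex.exp_ofReal_mul_I_re]
    ring
  · rw [Complex.neg_re, Complex.log_re]
    have : 1 - 2 * r * cos θ + r ^ 2 = ‖1 - z‖ ^ 2 := by
      rw [← Complex.normSq_eq_norm_sq, Complex.normSq_apply, hz]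
      simp only [Complex.sub_re, Complex.sub_im, Complex.one_re, Complex.one_im,
        Complex.re_ofReal_mul, Complex.im_ofReal_mul, Complex.exp_ofReal_mul_I_re,
        Complex.exp_ofReal_mul_I_im]
      linear_combination (-r ^ 2) * sin_sq_add_cos_sq θ
    rw [this, log_pow]
    push_cast
    ring

/-- The Abel regularisation of the kernel `-log |x - y|` on `[-R, R]`. -/
noncomputable def abelKernel (R r x y : ℝ) : ℝ :=
  log 2 - log R + ∑' n : ℕ, 2 / (n : ℝ) * r ^ n * (chebT n (x / R) * chebT n (y / R))

/-- `|1 - r e^{iθ}|²` -/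
noncomputable def poissonDen (r θ : ℝ) : ℝ := 1 - 2 * r * cos θ + r ^ 2

lemma poissonDen_pos {r : ℝ} (h0 : 0 ≤ r) (h1 : r < 1) (θ : ℝ) : 0 < poissonDen r θ := by
  unfold poissonDen
  nlinarith [cos_le_one θ, mul_nonneg h0 (sub_nonneg.2 (cos_le_one θ))]

lemma poissonDen_le {r : ℝ} (h0 : 0 ≤ r) (h1 : r < 1) (θ : ℝ) : poissonDen r θ ≤ 4 := by
  unfold poissonDen
  nlinarith [neg_one_le_cos θ, mul_nonneg h0 (sub_nonneg.2 (neg_one_le_cos θ))]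

/-- The difference of the two sides is (1 - r)². After taking logarithms this bounds the regularised
kernel by the true one with an error independent of the points. -/
lemma mul_poissonDen_one_le (r θ : ℝ) : r * poissonDen 1 θ ≤ poissonDen r θ := by
  unfold poissonDen
  nlinarith [sq_nonneg (1 - r)]

lemma poissonDen_one_mul (α φ : ℝ) :
    poissonDen 1 (α + φ) * poissonDen 1 (α - φ) = 4 * (cos α - cos φ) ^ 2 := by
  unfold poissonDen
  rw [cos_add, cos_sub]
  have h1 := sin_sq_add_cos_sq α
  have h2 := sin_sq_add_cos_sq φ
  have e1 : sin α ^ 2 = 1 - cos α ^ 2 := by linarith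
  have e2 : sin φ ^ 2 = 1 - cos φ ^ 2 := by linarith
  have : sin α ^ 2 * sin φ ^ 2 = (1 - cos α ^ 2) * (1 - cos φ ^ 2) := by rw [e1, e2]
  linear_combination (-4) * this

lemma poissonDen_one_nonneg (θ : ℝ) : 0 ≤ poissonDen 1 θ := by
  unfold poissonDen
  linarith [cos_le_one θ]

/-- The product formula 2 cos nα cos nφ = cos n(α + φ) + cos n(α - φ) splits the series into two
logarithmic series. The terms n = 0 vanish, since division by zero gives 0. -/
lemma abelKernel_eq {R r x y : ℝ} (hR : 0 < R) (h0 : 0 ≤ r) (h1 : r < 1)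
    (hx : x ∈ Icc (-R) R) (hy : y ∈ Icc (-R) R) :
    abelKernel R r x y = log 2 - log R
      - 1 / 2 * log (poissonDen r (arccos (x / R) + arccos (y / R)))
      - 1 / 2 * log (poissonDen r (arccos (x / R) - arccos (y / R))) := by
  have h := (hasSum_pow_mul_cos_div h0 h1 (arccos (x / R) + arccos (y / R))).add
    (hasSum_pow_mul_cos_div h0 h1 (arccos (x / R) - arccos (y / R)))
  rw [abelKernel]
  have e : ∀ n : ℕ, 2 / (n : ℝ) * r ^ n * (chebT n (x / R) * chebT n (y / R)) =
      r ^ n * cos (n * (arccos (x / R) + arccos (y / R))) / n +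
        r ^ n * cos (n * (arccos (x / R) - arccos (y / R))) / n := by
    intro n
    rw [chebT_div_eq hR hx, chebT_div_eq hR hy, mul_add, mul_sub, cos_add, cos_sub]
    ring
  simp_rw [e]
  rw [h.tsum_eq, poissonDen, poissonDen]
  ring

lemma poissonDen_arccos {R x y : ℝ} (hR : 0 < R) (hx : x ∈ Icc (-R) R) (hy : y ∈ Icc (-R) R) :
    poissonDen 1 (arccos (x / R) + arccos (y / R)) *
      poissonDen 1 (arccos (x / R) - arccos (y / R)) = (2 * |x - y| / R) ^ 2 := by
  rw [poissonDen_one_mul]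
  have h1 := mul_cos_arccos_div hR hx
  have h2 := mul_cos_arccos_div hR hy
  have : |x - y| ^ 2 = (R * (cos (arccos (x / R)) - cos (arccos (y / R)))) ^ 2 := by
    rw [sq_abs, mul_sub, h1, h2]
  rw [div_pow, mul_pow, this]
  field_simp
  ring

lemma neg_log_abs_sub_eq {R x y : ℝ} (hR : 0 < R) (hx : x ∈ Icc (-R) R) (hy : y ∈ Icc (-R) R)
    (hxy : x ≠ y) :
    0 < poissonDen 1 (arccos (x / R) + arccos (y / R)) ∧
    0 < poissonDen 1 (arccos (x / R) - arccos (y / R)) ∧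
    -log |x - y| = log 2 - log R
      - 1 / 2 * log (poissonDen 1 (arccos (x / R) + arccos (y / R)))
      - 1 / 2 * log (poissonDen 1 (arccos (x / R) - arccos (y / R))) := by
  have h := poissonDen_arccos hR hx hy
  have hpos : 0 < |x - y| := abs_pos.2 (sub_ne_zero.2 hxy)
  have hne : (2 * |x - y| / R) ^ 2 ≠ 0 := by positivity
  rw [← h] at hne
  have hA := (poissonDen_one_nonneg (arccos (x / R) + arccos (y / R))).lt_of_ne'
    (left_ne_zero_of_mul hne)
  have hB := (poissonDen_one_nonneg (arccos (x / R) - arccos (y / R))).lt_of_ne'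
    (right_ne_zero_of_mul hne)
  refine ⟨hA, hB, ?_⟩
  have h2 := congrArg log h
  rw [log_mul hA.ne' hB.ne', log_pow, log_div (by positivity) hR.ne',
    log_mul two_ne_zero hpos.ne'] at h2
  push_cast at h2
  linarith

lemma abelKernel_le {R r x y : ℝ} (hR : 0 < R) (h0 : 0 < r) (h1 : r < 1)
    (hx : x ∈ Icc (-R) R) (hy : y ∈ Icc (-R) R) (hxy : x ≠ y) :
    abelKernel R r x y ≤ -log |x - y| - log r := by
  obtain ⟨hA, hB, h⟩ := neg_log_abs_sub_eq hR hx hy hxy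
  rw [h, abelKernel_eq hR h0.le h1 hx hy]
  have k1 := log_le_log (mul_pos h0 hA) (mul_poissonDen_one_le r _)
  have k2 := log_le_log (mul_pos h0 hB) (mul_poissonDen_one_le r _)
  rw [log_mul h0.ne' hA.ne'] at k1
  rw [log_mul h0.ne' hB.ne'] at k2
  linarith

/-- A lower bound uniform in r, so that Fatou's lemma applies after a shift by log(2R). -/
lemma le_abelKernel {R r x y : ℝ} (hR : 0 < R) (h0 : 0 ≤ r) (h1 : r < 1)
    (hx : x ∈ Icc (-R) R) (hy : y ∈ Icc (-R) R) :
    -log (2 * R) ≤ abelKernel R r x y := by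
  rw [abelKernel_eq hR h0 h1 hx hy]
  have k1 := log_le_log (poissonDen_pos h0 h1 _)
    (poissonDen_le h0 h1 (arccos (x / R) + arccos (y / R)))
  have k2 := log_le_log (poissonDen_pos h0 h1 _)
    (poissonDen_le h0 h1 (arccos (x / R) - arccos (y / R)))
  have : log 4 = 2 * log 2 := by
    rw [show (4 : ℝ) = 2 ^ 2 by norm_num, log_pow]; norm_num
  rw [log_mul two_ne_zero hR.ne']
  linarith

lemma le_neg_log_abs_sub {R x y : ℝ} (hx : x ∈ Icc (-R) R) (hy : y ∈ Icc (-R) R)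
    (hxy : x ≠ y) : -log (2 * R) ≤ -log |x - y| := by
  have hpos : 0 < |x - y| := abs_pos.2 (sub_ne_zero.2 hxy)
  refine neg_le_neg (log_le_log hpos ?_)
  rw [abs_le]
  constructor <;> linarith [hx.1, hx.2, hy.1, hy.2]

lemma tendsto_abelKernel {R x y : ℝ} (hR : 0 < R)
    (hx : x ∈ Icc (-R) R) (hy : y ∈ Icc (-R) R) (hxy : x ≠ y) :
    Tendsto (fun r => abelKernel R r x y) (𝓝[<] 1) (𝓝 (-log |x - y|)) := by
  obtain ⟨hA, hB, h⟩ := neg_log_abs_sub_eq hR hx hy hxy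
  rw [h]
  have hc : ∀ θ, 0 < poissonDen 1 θ →
      Tendsto (fun r => 1 / 2 * log (poissonDen r θ)) (𝓝[<] 1) (𝓝 (1 / 2 * log (poissonDen 1 θ))) := by
    intro θ hθ
    have : ContinuousAt (fun r => poissonDen r θ) 1 := by
      unfold poissonDen; fun_prop
    exact ((this.log hθ.ne').tendsto.mono_left nhdsWithin_le_nhds).const_mul _
  refine (((tendsto_const_nhds (x := log 2 - log R)).sub (hc _ hA)).sub (hc _ hB)).congr' ?_
  filter_upwards [Ioo_mem_nhdsLT (show (0 : ℝ) < 1 by norm_num)] with r hr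
  rw [abelKernel_eq hR hr.1.le hr.2 hx hy]

/-- The square `[-R, R]²`. -/
def square (R : ℝ) : Set (ℝ × ℝ) := Icc (-R) R ×ˢ Icc (-R) R

lemma isCompact_square (R : ℝ) : IsCompact (square R) := isCompact_Icc.prod isCompact_Icc

/-- The summands of the regularised kernel are uniformly bounded on the square. -/
lemma abs_abelKernel_term_le {R r : ℝ} (hR : 0 < R) (h0 : 0 ≤ r) {p : ℝ × ℝ}
    (hp : p ∈ square R) (n : ℕ) :
    |2 / (n : ℝ) * r ^ n * (chebT n (p.1 / R) * chebT n (p.2 / R))| ≤ 2 * r ^ n := by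
  rw [abs_mul, abs_mul, abs_mul, abs_of_nonneg (pow_nonneg h0 n),
    abs_of_nonneg (show (0 : ℝ) ≤ 2 / n by positivity)]
  have h1 := abs_chebT_div_le_one hR hp.1 n
  have h2 := abs_chebT_div_le_one hR hp.2 n
  have h3 : (2 : ℝ) / n ≤ 2 := by
    rcases Nat.eq_zero_or_pos n with rfl | hn
    · simp
    · rw [div_le_iff₀ (by exact_mod_cast hn)]
      have : (1 : ℝ) ≤ n := by exact_mod_cast hn
      linarith
  have h4 : |chebT n (p.1 / R)| * |chebT n (p.2 / R)| ≤ 1 := mul_le_one₀ h1 (abs_nonneg _) h2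
  calc 2 / (n : ℝ) * r ^ n * (|chebT n (p.1 / R)| * |chebT n (p.2 / R)|)
      ≤ 2 / (n : ℝ) * r ^ n * 1 := by gcongr
    _ ≤ 2 * r ^ n := by rw [mul_one]; gcongr

lemma continuousOn_abelKernel {R r : ℝ} (hR : 0 < R) (h0 : 0 ≤ r) (h1 : r < 1) :
    ContinuousOn (fun p : ℝ × ℝ => abelKernel R r p.1 p.2) (square R) := by
  unfold abelKernel
  refine continuousOn_const.add (continuousOn_tsum (fun n => by fun_prop)
    ((summable_geometric_of_lt_one h0 h1).mul_left 2) fun n p hp => ?_)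
  exact abs_abelKernel_term_le hR h0 hp n

section
variable {R : ℝ} {ν : Measure (ℝ × ℝ)} [IsProbabilityMeasure ν]

lemma integrable_abelKernel (hR : 0 < R) (hν : ν (square R)ᶜ = 0) {r : ℝ} (h0 : 0 ≤ r)
    (h1 : r < 1) : Integrable (fun p : ℝ × ℝ => abelKernel R r p.1 p.2) ν :=
  integrable_of_continuousOn_of_compl_null (isCompact_square R) hν (continuousOn_abelKernel hR h0 h1)

lemma hasSum_integral_abelKernel (hR : 0 < R) (hν : ν (square R)ᶜ = 0) {r : ℝ} (h0 : 0 ≤ r)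
    (h1 : r < 1) :
    HasSum (fun n : ℕ => 2 / (n : ℝ) * r ^ n * ∫ p, chebT n (p.1 / R) * chebT n (p.2 / R) ∂ν)
      (∫ p, abelKernel R r p.1 p.2 ∂ν - (log 2 - log R)) := by
  have hi : ∀ n : ℕ, Integrable
      (fun p : ℝ × ℝ => 2 / (n : ℝ) * r ^ n * (chebT n (p.1 / R) * chebT n (p.2 / R))) ν :=
    fun n => integrable_of_continuousOn_of_compl_null (isCompact_square R) hν
      (Continuous.continuousOn (by fun_prop))
  have hae : ∀ᵐ p ∂ν, p ∈ square R := mem_ae_iff.2 hν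
  have hs : Summable fun n : ℕ =>
      ∫ p, ‖2 / (n : ℝ) * r ^ n * (chebT n (p.1 / R) * chebT n (p.2 / R))‖ ∂ν := by
    refine Summable.of_nonneg_of_le (fun n => integral_nonneg fun _ => norm_nonneg _) (fun n => ?_)
      ((summable_geometric_of_lt_one h0 h1).mul_left 2)
    have := integral_mono_ae (hi n).norm (integrable_const (2 * r ^ n)) (by
      filter_upwards [hae] with p hp using abs_abelKernel_term_le hR h0 hp n)
    simpa using this
  have h := hasSum_integral_of_summable_integral_norm hi hs
  simp only [MeasureTheory.integral_const_mul] at h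
  have e : ∀ p : ℝ × ℝ, ∑' n : ℕ, 2 / (n : ℝ) * r ^ n * (chebT n (p.1 / R) * chebT n (p.2 / R)) =
      abelKernel R r p.1 p.2 - (log 2 - log R) := fun p => by rw [abelKernel]; ring
  rw [integral_congr_ae (Eventually.of_forall e),
    integral_sub (integrable_abelKernel hR hν h0 h1) (integrable_const _)] at h
  simpa only [integral_const, probReal_univ, one_smul] using h

lemma integral_abelKernel_le (hR : 0 < R) (hν : ν (square R)ᶜ = 0)
    (hdiag : ν {p | p.1 = p.2} = 0) (hint : Integrable (fun p : ℝ × ℝ => -log |p.1 - p.2|) ν)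
    {r : ℝ} (h0 : 0 < r) (h1 : r < 1) :
    ∫ p, abelKernel R r p.1 p.2 ∂ν ≤ ∫ p, -log |p.1 - p.2| ∂ν - log r := by
  have hae : ∀ᵐ p ∂ν, p ∈ square R := mem_ae_iff.2 hν
  have hd : ∀ᵐ p ∂ν, p.1 ≠ p.2 := by rw [ae_iff]; simpa using hdiag
  have := integral_mono_ae (integrable_abelKernel hR hν h0.le h1)
    (hint.sub (integrable_const (log r))) (by
      filter_upwards [hae, hd] with p hp hp' using abelKernel_le hR h0 h1 hp.1 hp.2 hp')
  rw [integral_sub' hint (integrable_const _)] at this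
  simpa only [integral_const, probReal_univ, one_smul] using this

/-- Fatou's lemma for the shifted kernels gives integrability and the upper bound B; the lower bound
is `integral_abelKernel_le`, whose error -log r tends to 0. -/
lemma integrable_neg_log_of_tendsto (hR : 0 < R) (hν : ν (square R)ᶜ = 0)
    (hdiag : ν {p | p.1 = p.2} = 0) {B : ℝ}
    (hB : Tendsto (fun r => ∫ p, abelKernel R r p.1 p.2 ∂ν) (𝓝[<] 1) (𝓝 B)) :
    Integrable (fun p : ℝ × ℝ => -log |p.1 - p.2|) ν ∧ ∫ p, -log |p.1 - p.2| ∂ν = B := by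
  have hae : ∀ᵐ p ∂ν, p ∈ square R := mem_ae_iff.2 hν
  have hd : ∀ᵐ p ∂ν, p.1 ≠ p.2 := by rw [ae_iff]; simpa using hdiag
  set c := log (2 * R) with hc
  -- The shift by 2 keeps r k strictly positive also at k = 0.
  set r : ℕ → ℝ := fun k => 1 - 1 / ((k : ℝ) + 2) with hr
  have hr0 : ∀ k, 0 < r k := fun k => by
    have : 1 / ((k : ℝ) + 2) < 1 := by
      rw [div_lt_one (by positivity)]; linarith [(Nat.cast_nonneg k : (0 : ℝ) ≤ k)]
    simp only [hr]; linarith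
  have hr1 : ∀ k, r k < 1 := fun k => by
    have : 0 < 1 / ((k : ℝ) + 2) := by positivity
    simp only [hr]; linarith
  have hrt : Tendsto r atTop (𝓝[<] 1) := by
    refine tendsto_nhdsWithin_iff.2 ⟨?_, Eventually.of_forall hr1⟩
    have h := (tendsto_one_div_add_atTop_nhds_zero_nat (𝕜 := ℝ)).comp (tendsto_add_atTop_nat 1)
    have := h.const_sub 1
    simp only [sub_zero] at this
    refine this.congr fun k => ?_
    simp only [Function.comp_apply, hr]; push_cast; ring
  have hK : ∀ k, Integrable (fun p : ℝ × ℝ => abelKernel R (r k) p.1 p.2) ν := fun k =>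
    integrable_abelKernel hR hν (hr0 k).le (hr1 k)
  have hmeas : Measurable fun p : ℝ × ℝ => -log |p.1 - p.2| := by fun_prop
  have hnn : 0 ≤ᵐ[ν] fun p : ℝ × ℝ => -log |p.1 - p.2| + c := by
    filter_upwards [hae, hd] with p hp hp'
    have := le_neg_log_abs_sub hp.1 hp.2 hp'
    simp only [Pi.zero_apply]; linarith
  have hlim := (hB.comp hrt).add_const c
  have key : ∫⁻ p, ENNReal.ofReal (-log |p.1 - p.2| + c) ∂ν ≤ ENNReal.ofReal (B + c) := by
    calc ∫⁻ p, ENNReal.ofReal (-log |p.1 - p.2| + c) ∂ν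
        = ∫⁻ p, liminf (fun k => ENNReal.ofReal (abelKernel R (r k) p.1 p.2 + c)) atTop ∂ν := by
          refine lintegral_congr_ae ?_
          filter_upwards [hae, hd] with p hp hp'
          have := ((tendsto_abelKernel hR hp.1 hp.2 hp').comp hrt).add_const c
          exact ((ENNReal.tendsto_ofReal this).liminf_eq).symm
      _ ≤ liminf (fun k => ∫⁻ p, ENNReal.ofReal (abelKernel R (r k) p.1 p.2 + c) ∂ν) atTop :=
          lintegral_liminf_le' fun k =>
            (((hK k).add (integrable_const c)).aestronglyMeasurable.aemeasurable).ennreal_ofReal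
      _ = ENNReal.ofReal (B + c) := by
          refine Tendsto.liminf_eq ?_
          refine (ENNReal.tendsto_ofReal hlim).congr fun k => ?_
          have hKc : Integrable (fun p : ℝ × ℝ => abelKernel R (r k) p.1 p.2 + c) ν :=
            (hK k).add (integrable_const c)
          rw [← ofReal_integral_eq_lintegral_ofReal hKc]
          · congr 1
            rw [integral_add (hK k) (integrable_const c)]
            simp
          · filter_upwards [hae] with p hp
            have := le_abelKernel hR (hr0 k).le (hr1 k) hp.1 hp.2
            simp only [Pi.zero_apply]; linarith
  have hint' : Integrable (fun p : ℝ × ℝ => -log |p.1 - p.2| + c) ν :=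
    (lintegral_ofReal_ne_top_iff_integrable (hmeas.add_const c).aestronglyMeasurable hnn).1
      (key.trans_lt ENNReal.ofReal_lt_top).ne
  have hint : Integrable (fun p : ℝ × ℝ => -log |p.1 - p.2|) ν := by
    refine (hint'.sub (integrable_const c)).congr (Eventually.of_forall fun p => ?_)
    simp only [Pi.sub_apply]; ring
  refine ⟨hint, le_antisymm ?_ ?_⟩
  · have h2 : 0 ≤ B + c := by
      refine ge_of_tendsto' hlim fun k => ?_
      have : ∫ p, -c ∂ν ≤ ∫ p, abelKernel R (r k) p.1 p.2 ∂ν := by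
        refine integral_mono_ae (integrable_const _) (hK k) ?_
        filter_upwards [hae] with p hp using le_abelKernel hR (hr0 k).le (hr1 k) hp.1 hp.2
      simp at this
      simp only [Function.comp_apply]; linarith
    rw [← ofReal_integral_eq_lintegral_ofReal hint' hnn, ENNReal.ofReal_le_ofReal_iff h2,
      integral_add hint (integrable_const c)] at key
    simpa using key
  · have hlog : Tendsto (fun k => ∫ p, -log |p.1 - p.2| ∂ν - log (r k)) atTop
        (𝓝 (∫ p, -log |p.1 - p.2| ∂ν - log 1)) :=
      (((continuousAt_log one_ne_zero).tendsto.comp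
        (hrt.mono_right nhdsWithin_le_nhds))).const_sub _
    rw [log_one, sub_zero] at hlog
    exact le_of_tendsto_of_tendsto' (hB.comp hrt) hlog fun k =>
      integral_abelKernel_le hR hν hdiag hint (hr0 k) (hr1 k)

end

lemma tendsto_tsum_pow_mul {a : ℕ → ℝ} (ha : Summable fun n => |a n|) :
    Tendsto (fun r : ℝ => ∑' n, r ^ n * a n) (𝓝[<] 1) (𝓝 (∑' n, a n)) := by
  refine tendsto_tsum_of_dominated_convergence (bound := fun n => |a n|) ha (fun n => ?_) ?_
  · have : Continuous fun r : ℝ => r ^ n * a n := by fun_prop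
    have h := this.tendsto 1
    simp only [one_pow, one_mul] at h
    exact h.mono_left nhdsWithin_le_nhds
  · filter_upwards [Ioo_mem_nhdsLT (show (0 : ℝ) < 1 by norm_num)] with r hr n
    rw [norm_mul, norm_pow, norm_of_nonneg hr.1.le]
    exact mul_le_of_le_one_left (abs_nonneg _) (pow_le_one₀ hr.1.le hr.2.le)

/-- Integral of the logarithmic kernel when the series of moments converges absolutely. -/
lemma integral_neg_log_eq_tsum {R : ℝ} {ν : Measure (ℝ × ℝ)} [IsProbabilityMeasure ν] (hR : 0 < R)
    (hν : ν (square R)ᶜ = 0) (hdiag : ν {p | p.1 = p.2} = 0)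
    (hs : Summable fun n : ℕ => |2 / (n : ℝ) * ∫ p, chebT n (p.1 / R) * chebT n (p.2 / R) ∂ν|) :
    Integrable (fun p : ℝ × ℝ => -log |p.1 - p.2|) ν ∧ ∫ p, -log |p.1 - p.2| ∂ν =
      log 2 - log R + ∑' n : ℕ, 2 / (n : ℝ) * ∫ p, chebT n (p.1 / R) * chebT n (p.2 / R) ∂ν := by
  refine integrable_neg_log_of_tendsto hR hν hdiag ?_
  refine ((tendsto_tsum_pow_mul hs).const_add (log 2 - log R)).congr' ?_
  filter_upwards [Ioo_mem_nhdsLT (show (0 : ℝ) < 1 by norm_num)] with r hr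
  have := (hasSum_integral_abelKernel hR hν hr.1.le hr.2).tsum_eq
  rw [eq_sub_iff_add_eq] at this
  rw [← this, add_comm]
  congr 1
  exact tsum_congr fun n => by ring

/-! ### The energy as a real integral -/

/-- The integrand of the energy off the diagonal. -/
noncomputable def pairEnergy (V : ℝ → ℝ) (p : ℝ × ℝ) : ℝ :=
  1 / 2 * (-log |p.1 - p.2| + (V p.1 + V p.2))

lemma energy_integrand_eq (V : ℝ → ℝ) :
    (fun p : ℝ × ℝ => ((1 / 2 : ℝ) : EReal) * (logInteraction (p.1 - p.2) + ((V p.1 + V p.2 : ℝ) : EReal)))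
      = fun p => if p.1 = p.2 then ⊤ else (pairEnergy V p : EReal) := by
  ext p
  by_cases h : p.1 = p.2
  · simp only [h, sub_self, logInteraction, if_true, EReal.top_add_coe]
    exact EReal.coe_mul_top_of_pos (by norm_num)
  · rw [if_neg h, logInteraction, if_neg (sub_ne_zero.2 h), pairEnergy]
    norm_cast

lemma eintegral_coe {α : Type*} [MeasurableSpace α] {μ : Measure α} {f : α → ℝ} {F : α → EReal}
    (hf : Integrable f μ) (h : F =ᵐ[μ] fun a => (f a : EReal)) :
    eintegral μ F = ((∫ a, f a ∂μ : ℝ) : EReal) := by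
  have h1 : ∫⁻ a, (F a).toENNReal ∂μ = ∫⁻ a, ENNReal.ofReal (f a) ∂μ :=
    lintegral_congr_ae (by filter_upwards [h] with a ha; rw [ha, EReal.toENNReal_of_ne_top (by simp), EReal.toReal_coe])
  have h2 : ∫⁻ a, (-F a).toENNReal ∂μ = ∫⁻ a, ENNReal.ofReal (-f a) ∂μ :=
    lintegral_congr_ae (by
      filter_upwards [h] with a ha
      rw [ha, ← EReal.coe_neg, EReal.toENNReal_of_ne_top (by simp), EReal.toReal_coe])
  have f1 : ∫⁻ a, ENNReal.ofReal (f a) ∂μ ≠ ⊤ := hf.lintegral_lt_top.ne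
  have f2 : ∫⁻ a, ENNReal.ofReal (-f a) ∂μ ≠ ⊤ := hf.neg.lintegral_lt_top.ne
  rw [eintegral, h1, h2, integral_eq_lintegral_pos_part_sub_lintegral_neg_part hf, EReal.coe_sub,
    EReal.coe_ennreal_toReal f1, EReal.coe_ennreal_toReal f2]

lemma energy_eq_integral {V : ℝ → ℝ} {μ : Measure ℝ}
    (hdiag : μ.prod μ {p | p.1 = p.2} = 0) (hf : Integrable (pairEnergy V) (μ.prod μ)) :
    energy V μ = ((∫ p, pairEnergy V p ∂(μ.prod μ) : ℝ) : EReal) := by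
  rw [energy, energy_integrand_eq]
  refine eintegral_coe hf ?_
  have hd : ∀ᵐ p ∂(μ.prod μ), p.1 ≠ p.2 := by rw [ae_iff]; simpa using hdiag
  filter_upwards [hd] with p hp
  rw [if_neg hp]

lemma measurable_pairEnergy {V : ℝ → ℝ} (hV : Continuous V) : Measurable (pairEnergy V) := by
  unfold pairEnergy
  have := hV.measurable
  fun_prop

/-- A competitor may have atoms or infinite energy. With the integrand bounded below, finite energy
means that its positive part has a finite integral, and the value ⊤ on the diagonal then forces the
diagonal to be null. -/
lemma integrable_pairEnergy_of_energy_ne_top {V : ℝ → ℝ} (hV : Continuous V) {μ : Measure ℝ}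
    [IsProbabilityMeasure μ] {M : ℝ}
    (hM : ∀ᵐ p ∂(μ.prod μ), p.1 ≠ p.2 → -M ≤ pairEnergy V p) (he : energy V μ ≠ ⊤) :
    μ.prod μ {p | p.1 = p.2} = 0 ∧ Integrable (pairEnergy V) (μ.prod μ) := by
  rw [energy, energy_integrand_eq, eintegral] at he
  set F : ℝ × ℝ → EReal := fun p => if p.1 = p.2 then ⊤ else (pairEnergy V p : EReal) with hF
  have hmeas := measurable_pairEnergy hV
  have hFm : Measurable F :=
    Measurable.ite (measurableSet_eq_fun measurable_fst measurable_snd) measurable_const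
      hmeas.coe_real_ereal
  -- This comes first because ⊤ - ⊤ = ⊥ in `EReal`: without it, energy ≠ ⊤ would not bound the
  -- positive part.
  have hneg : ∫⁻ p, (-F p).toENNReal ∂(μ.prod μ) ≠ ⊤ := by
    have : ∫⁻ p, (-F p).toENNReal ∂(μ.prod μ) ≤ ∫⁻ _, ENNReal.ofReal M ∂(μ.prod μ) := by
      refine lintegral_mono_ae ?_
      filter_upwards [hM] with p hp
      by_cases h : p.1 = p.2
      · simp [hF, h]
      · simp only [hF, if_neg h]
        rw [← EReal.coe_neg, EReal.toENNReal_of_ne_top (by simp), EReal.toReal_coe]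
        exact ENNReal.ofReal_le_ofReal (by linarith [hp h])
    refine (this.trans_lt ?_).ne
    simp
  have hpos : ∫⁻ p, (F p).toENNReal ∂(μ.prod μ) ≠ ⊤ := by
    intro h
    refine he ?_
    rw [h]
    rw [← EReal.coe_ennreal_toReal hneg]
    exact EReal.top_sub_coe _
  have hd : ∀ᵐ p ∂(μ.prod μ), p.1 ≠ p.2 := by
    filter_upwards [ae_lt_top' hFm.ereal_toENNReal.aemeasurable hpos] with p hp h
    simp [hF, h] at hp
  refine ⟨by rw [ae_iff] at hd; simpa using hd, ?_⟩
  have hnn : 0 ≤ᵐ[μ.prod μ] fun p => pairEnergy V p + M := by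
    filter_upwards [hd, hM] with p hp hp'
    simp only [Pi.zero_apply]; linarith [hp' hp]
  have hint : Integrable (fun p => pairEnergy V p + M) (μ.prod μ) := by
    refine (lintegral_ofReal_ne_top_iff_integrable (hmeas.add_const M).aestronglyMeasurable hnn).1 ?_
    have : ∫⁻ p, ENNReal.ofReal (pairEnergy V p + M) ∂(μ.prod μ) ≤
        ∫⁻ p, ((F p).toENNReal + ENNReal.ofReal M) ∂(μ.prod μ) := by
      refine lintegral_mono_ae ?_
      filter_upwards [hd] with p hp
      simp only [hF, if_neg hp]
      rw [EReal.toENNReal_of_ne_top (by simp), EReal.toReal_coe]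
      exact ENNReal.ofReal_add_le
    refine (this.trans_lt ?_).ne
    rw [lintegral_add_right _ measurable_const]
    refine ENNReal.add_lt_top.2 ⟨hpos.lt_top, by simp⟩
  refine (hint.sub (integrable_const M)).congr (Eventually.of_forall fun p => ?_)
  simp

lemma prod_compl_square {R : ℝ} {μ ρ : Measure ℝ} (hμ : μ (Icc (-R) R)ᶜ = 0) (hρ : ρ (Icc (-R) R)ᶜ = 0) :
    μ.prod ρ (square R)ᶜ = 0 := by
  have h1 : ∀ᵐ x ∂μ, x ∈ Icc (-R) R := mem_ae_iff.2 hμ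
  have h2 : ∀ᵐ x ∂ρ, x ∈ Icc (-R) R := mem_ae_iff.2 hρ
  refine mem_ae_iff.1 (?_ : ∀ᵐ p ∂(μ.prod ρ), p ∈ square R)
  filter_upwards [Measure.quasiMeasurePreserving_fst.ae h1,
    Measure.quasiMeasurePreserving_snd.ae h2] with p hp hp' using ⟨hp, hp'⟩

lemma le_pairEnergy {R : ℝ} {μ : Measure ℝ} (hμ : μ (Icc (-R) R)ᶜ = 0) {V : ℝ → ℝ} (hV : Continuous V) :
    ∃ M, ∀ᵐ p ∂(μ.prod μ), p.1 ≠ p.2 → -M ≤ pairEnergy V p := by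
  obtain ⟨m, hm⟩ := (isCompact_Icc (a := -R) (b := R)).bddBelow_image hV.continuousOn
  refine ⟨1 / 2 * log (2 * R) - m, ?_⟩
  filter_upwards [show ∀ᵐ p ∂(μ.prod μ), p ∈ square R from
    mem_ae_iff.2 (prod_compl_square hμ hμ)] with p hp hne
  have h1 := hm (mem_image_of_mem V hp.1)
  have h2 := hm (mem_image_of_mem V hp.2)
  have h3 := le_neg_log_abs_sub hp.1 hp.2 hne
  unfold pairEnergy
  linarith

lemma prod_diag_eq_zero {μ ρ : Measure ℝ} [SFinite ρ] [NullSingletonClass ρ] : μ.prod ρ {p | p.1 = p.2} = 0 := by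
  rw [Measure.measure_prod_null (measurableSet_eq_fun measurable_fst measurable_snd)]
  refine Eventually.of_forall fun x => ?_
  have : Prod.mk x ⁻¹' {p : ℝ × ℝ | p.1 = p.2} = {x} := by ext y; simp [eq_comm]
  simp only [this, measure_singleton, Pi.zero_apply]

/-! ### Chebyshev moments and the Euler-Lagrange conditions -/

section
variable {R : ℝ} {μ ρ : Measure ℝ} [IsProbabilityMeasure μ] [IsProbabilityMeasure ρ]

/-- The Chebyshev moments of a measure on `[-R, R]`. -/
noncomputable def chebMoment (R : ℝ) (μ : Measure ℝ) (n : ℕ) : ℝ := ∫ x, chebT n (x / R) ∂μ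

lemma integral_prod_chebT (R : ℝ) (n : ℕ) :
    ∫ p, chebT n (p.1 / R) * chebT n (p.2 / R) ∂(μ.prod ρ) = chebMoment R μ n * chebMoment R ρ n :=
  integral_prod_mul (fun x => chebT n (x / R)) (fun x => chebT n (x / R))

/-- Lower bound of the logarithmic energy by the moments. -/
lemma summable_chebMoment_sq (hR : 0 < R) (hμ : μ (Icc (-R) R)ᶜ = 0)
    (hdiag : μ.prod μ {p | p.1 = p.2} = 0)
    (hint : Integrable (fun p : ℝ × ℝ => -log |p.1 - p.2|) (μ.prod μ)) :
    Summable (fun n : ℕ => 2 / (n : ℝ) * chebMoment R μ n ^ 2) ∧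
    log 2 - log R + ∑' n : ℕ, 2 / (n : ℝ) * chebMoment R μ n ^ 2 ≤
      ∫ p, -log |p.1 - p.2| ∂(μ.prod μ) := by
  have hsq := prod_compl_square hμ hμ
  set I := ∫ p, -log |p.1 - p.2| ∂(μ.prod μ) with hI
  have hnn : ∀ n : ℕ, 0 ≤ 2 / (n : ℝ) * chebMoment R μ n ^ 2 := fun n => by positivity
  -- Summability is not known in advance. For fixed r a finite sum of nonnegative terms lies below
  -- the Abel sum; then r ↑ 1 with s fixed.
  have hfin : ∀ s : Finset ℕ, ∑ n ∈ s, 2 / (n : ℝ) * chebMoment R μ n ^ 2 ≤ I - (log 2 - log R) := by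
    intro s
    have hr : ∀ r ∈ Ioo (0 : ℝ) 1, ∑ n ∈ s, r ^ n * (2 / (n : ℝ) * chebMoment R μ n ^ 2) ≤
        I - log r - (log 2 - log R) := by
      intro r hr
      have h := hasSum_integral_abelKernel hR hsq hr.1.le hr.2
      simp only [integral_prod_chebT] at h
      have h2 := integral_abelKernel_le hR hsq hdiag hint hr.1 hr.2
      have h3 := sum_le_hasSum s (fun n _ => by
        have := hr.1
        have := mul_self_nonneg (chebMoment R μ n)
        positivity) h
      calc _ = ∑ n ∈ s, 2 / (n : ℝ) * r ^ n * (chebMoment R μ n * chebMoment R μ n) :=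
            Finset.sum_congr rfl fun n _ => by ring
        _ ≤ _ := by linarith
    have c1 : ContinuousAt (fun r : ℝ => ∑ n ∈ s, r ^ n * (2 / (n : ℝ) * chebMoment R μ n ^ 2)) 1 :=
      Continuous.continuousAt (by fun_prop)
    have c2 : ContinuousAt (fun r : ℝ => I - log r - (log 2 - log R)) 1 := by
      have := continuousAt_log (one_ne_zero (α := ℝ))
      fun_prop
    have := le_of_tendsto_of_tendsto (c1.tendsto.mono_left (nhdsWithin_le_nhds (s := Iio 1)))
      (c2.tendsto.mono_left nhdsWithin_le_nhds) (by
        filter_upwards [Ioo_mem_nhdsLT (show (0 : ℝ) < 1 by norm_num)] with r h using hr r h)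
    simpa using this
  have hs := summable_of_sum_le hnn hfin
  exact ⟨hs, by linarith [hs.tsum_le_of_sum_le hfin]⟩

/-- The mutual energy: |ab| ≤ a² + b² gives absolute convergence from the two self-energy series,
and the diagonal is null because ρ has no atoms. -/
lemma integral_neg_log_prod_eq (hR : 0 < R) (hμ : μ (Icc (-R) R)ᶜ = 0)
    (hρ : ρ (Icc (-R) R)ᶜ = 0) [NullSingletonClass ρ]
    (h1 : Summable (fun n : ℕ => 2 / (n : ℝ) * chebMoment R μ n ^ 2))
    (h2 : Summable (fun n : ℕ => 2 / (n : ℝ) * chebMoment R ρ n ^ 2)) :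
    Summable (fun n : ℕ => 2 / (n : ℝ) * (chebMoment R μ n * chebMoment R ρ n)) ∧
    Integrable (fun p : ℝ × ℝ => -log |p.1 - p.2|) (μ.prod ρ) ∧
    ∫ p, -log |p.1 - p.2| ∂(μ.prod ρ) =
      log 2 - log R + ∑' n : ℕ, 2 / (n : ℝ) * (chebMoment R μ n * chebMoment R ρ n) := by
  have hs : Summable fun n : ℕ => |2 / (n : ℝ) * (chebMoment R μ n * chebMoment R ρ n)| := by
    refine Summable.of_nonneg_of_le (fun _ => abs_nonneg _) (fun n => ?_) (h1.add h2)
    have h0 : (0 : ℝ) ≤ 2 / n := by positivity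
    rw [abs_mul, abs_of_nonneg h0, ← mul_add]
    refine mul_le_mul_of_nonneg_left ?_ h0
    rw [abs_le]
    constructor <;> nlinarith [sq_nonneg (chebMoment R μ n + chebMoment R ρ n),
      sq_nonneg (chebMoment R μ n - chebMoment R ρ n), sq_nonneg (chebMoment R μ n),
      sq_nonneg (chebMoment R ρ n)]
  refine ⟨hs.of_abs, ?_⟩
  have := integral_neg_log_eq_tsum hR (prod_compl_square hμ hρ) prod_diag_eq_zero (by
    simpa only [integral_prod_chebT] using hs)
  simpa only [integral_prod_chebT] using this

lemma integrable_of_continuous (hμ : μ (Icc (-R) R)ᶜ = 0) {V : ℝ → ℝ} (hV : Continuous V) :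
    Integrable V μ :=
  integrable_of_continuousOn_of_compl_null isCompact_Icc hμ hV.continuousOn

lemma integrable_pairEnergy_iff (hμ : μ (Icc (-R) R)ᶜ = 0) {V : ℝ → ℝ} (hV : Continuous V) :
    Integrable (pairEnergy V) (μ.prod μ) ↔
      Integrable (fun p : ℝ × ℝ => -log |p.1 - p.2|) (μ.prod μ) := by
  have hv : Integrable (fun p : ℝ × ℝ => V p.1 + V p.2) (μ.prod μ) :=
    ((integrable_of_continuous hμ hV).comp_fst μ).add ((integrable_of_continuous hμ hV).comp_snd μ)
  constructor
  · intro h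
    refine ((h.const_mul 2).sub hv).congr (Eventually.of_forall fun p => ?_)
    simp only [Pi.sub_apply, pairEnergy]; ring
  · intro h
    exact (h.add hv).const_mul (1 / 2)

lemma integral_pairEnergy (hμ : μ (Icc (-R) R)ᶜ = 0) {V : ℝ → ℝ} (hV : Continuous V)
    (h : Integrable (fun p : ℝ × ℝ => -log |p.1 - p.2|) (μ.prod μ)) :
    ∫ p, pairEnergy V p ∂(μ.prod μ) =
      1 / 2 * ∫ p, -log |p.1 - p.2| ∂(μ.prod μ) + ∫ x, V x ∂μ := by
  have hi := integrable_of_continuous hμ hV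
  have h1 : Integrable (fun p : ℝ × ℝ => V p.1) (μ.prod μ) := hi.comp_fst μ
  have h2 : Integrable (fun p : ℝ × ℝ => V p.2) (μ.prod μ) := hi.comp_snd μ
  have h12 : Integrable (fun p : ℝ × ℝ => V p.1 + V p.2) (μ.prod μ) := h1.add h2
  unfold pairEnergy
  rw [integral_const_mul, integral_add h h12, integral_add h1 h2, integral_fun_fst,
    integral_fun_snd]
  simp only [probReal_univ, one_smul]
  ring

/-- Comparison of the energies of a measure with the energy of a measure that satisfies the
Euler-Lagrange conditions. -/
lemma energy_sub_ge (hR : 0 < R) (hμ : μ (Icc (-R) R)ᶜ = 0) (hρ : ρ (Icc (-R) R)ᶜ = 0) [NullSingletonClass ρ]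
    {V : ℝ → ℝ} (hV : Continuous V)
    (hint : Integrable (fun p : ℝ × ℝ => -log |p.1 - p.2|) (ρ.prod ρ)) {C : ℝ}
    (hge : ∀ x ∈ Icc (-R) R, C ≤ V x + ∫ y, -log |x - y| ∂ρ)
    (heq : ∀ᵐ x ∂ρ, V x + ∫ y, -log |x - y| ∂ρ = C) (he : energy V μ ≠ ⊤) :
    ∃ e e₀ : ℝ, energy V μ = e ∧ energy V ρ = e₀ ∧
      Summable (fun n : ℕ => 2 / (n : ℝ) * (chebMoment R μ n - chebMoment R ρ n) ^ 2) ∧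
      e₀ + 1 / 2 * ∑' n : ℕ, 2 / (n : ℝ) * (chebMoment R μ n - chebMoment R ρ n) ^ 2 ≤ e := by
  obtain ⟨M, hM⟩ := le_pairEnergy (μ := μ) hμ hV
  obtain ⟨hdμ, hiμ⟩ := integrable_pairEnergy_of_energy_ne_top hV hM he
  have hlμ := (integrable_pairEnergy_iff hμ hV).1 hiμ
  have hdρ : ρ.prod ρ {p | p.1 = p.2} = 0 := prod_diag_eq_zero
  obtain ⟨sμ, hIμ⟩ := summable_chebMoment_sq hR hμ hdμ hlμ
  obtain ⟨sρ, -⟩ := summable_chebMoment_sq hR hρ hdρ hint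
  obtain ⟨sc, hci, hIc⟩ := integral_neg_log_prod_eq hR hμ hρ sμ sρ
  obtain ⟨sd, -, hIρ⟩ := integral_neg_log_prod_eq hR hρ hρ sρ sρ
  -- This expands I(μ, μ) - 2 I(μ, ρ) + I(ρ, ρ) for the logarithmic energy I; the constants log 2 -
  -- log R cancel because the masses agree. Only an inequality is known for I(μ, μ), in the useful
  -- direction.
  have hsq : ∀ n : ℕ, 2 / (n : ℝ) * (chebMoment R μ n - chebMoment R ρ n) ^ 2 =
      2 / (n : ℝ) * chebMoment R μ n ^ 2 -
        2 * (2 / (n : ℝ) * (chebMoment R μ n * chebMoment R ρ n)) +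
        2 / (n : ℝ) * (chebMoment R ρ n * chebMoment R ρ n) := fun n => by ring
  have hsum := (sμ.hasSum.sub (sc.hasSum.mul_left 2)).add sd.hasSum
  simp_rw [← hsq] at hsum
  refine ⟨_, _, energy_eq_integral hdμ hiμ,
    energy_eq_integral hdρ ((integrable_pairEnergy_iff hρ hV).2 hint), hsum.summable, ?_⟩
  rw [hsum.tsum_eq, integral_pairEnergy hμ hV hlμ, integral_pairEnergy hρ hV hint]
  have k1 : C ≤ ∫ x, V x ∂μ + ∫ p, -log |p.1 - p.2| ∂(μ.prod ρ) := by
    rw [integral_prod _ hci, ← integral_add (integrable_of_continuous hμ hV) hci.integral_prod_left]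
    have := integral_mono_ae (integrable_const C)
      ((integrable_of_continuous hμ hV).add hci.integral_prod_left) (by
        filter_upwards [show ∀ᵐ x ∂μ, x ∈ Icc (-R) R from mem_ae_iff.2 hμ] with x hx
        exact hge x hx)
    simpa only [integral_const, probReal_univ, one_smul, Pi.add_apply] using this
  have k2 : ∫ x, V x ∂ρ + ∫ p, -log |p.1 - p.2| ∂(ρ.prod ρ) = C := by
    rw [integral_prod _ hint,
      ← integral_add (integrable_of_continuous hρ hV) hint.integral_prod_left,
      integral_congr_ae heq]
    simp
  linarith

lemma integral_eq_tsum_chebMoment (hR : 0 < R) (hμ : μ (Icc (-R) R)ᶜ = 0)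
    {W : ℝ → ℝ} (hW : ContDiff ℝ 3 W) :
    ∫ x, W x ∂μ = ∑' n, chebCoeff W R n * chebMoment R μ n := by
  have hae : ∀ᵐ x ∂μ, x ∈ Icc (-R) R := mem_ae_iff.2 hμ
  have hi : ∀ n : ℕ, Integrable (fun x => chebCoeff W R n * chebT n (x / R)) μ :=
    fun n => integrable_of_continuous hμ (by fun_prop)
  have hs : Summable fun n : ℕ => ∫ x, ‖chebCoeff W R n * chebT n (x / R)‖ ∂μ := by
    refine Summable.of_nonneg_of_le (fun n => integral_nonneg fun _ => norm_nonneg _) (fun n => ?_)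
      (summable_abs_chebCoeff hW R)
    have := integral_mono_ae (hi n).norm (integrable_const |chebCoeff W R n|) (by
      filter_upwards [hae] with x hx
      rw [norm_mul]
      exact mul_le_of_le_one_right (abs_nonneg _) (abs_chebT_div_le_one hR hx n))
    simpa using this
  have h := hasSum_integral_of_summable_integral_norm hi hs
  simp only [MeasureTheory.integral_const_mul] at h
  rw [show (∑' n, chebCoeff W R n * chebMoment R μ n) = _ from h.tsum_eq]
  refine integral_congr_ae ?_
  filter_upwards [hae] with x hx using (hasSum_chebCoeff hW hR hx).tsum_eq.symm

/-- Chebyshev moments determine a measure on `[-R, R]`. -/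
lemma eq_of_chebMoment_eq (hR : 0 < R) (hμ : μ (Icc (-R) R)ᶜ = 0) (hρ : ρ (Icc (-R) R)ᶜ = 0)
    (h : ∀ n, chebMoment R μ n = chebMoment R ρ n) : μ = ρ := by
  refine Measure.ext_of_charFun (funext fun t => ?_)
  -- The functions cos(tx) and sin(tx) are sums of their Chebyshev series, so the moments determine
  -- the characteristic function.
  have hcos : ContDiff ℝ 3 fun x => cos (t * x) := by fun_prop
  have hsin : ContDiff ℝ 3 fun x => sin (t * x) := by fun_prop
  have hW : ∀ {W : ℝ → ℝ}, ContDiff ℝ 3 W → ∫ x, W x ∂μ = ∫ x, W x ∂ρ := fun hW => by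
    rw [integral_eq_tsum_chebMoment hR hμ hW, integral_eq_tsum_chebMoment hR hρ hW]
    simp_rw [h]
  have key : ∀ {m : Measure ℝ} [IsProbabilityMeasure m], m (Icc (-R) R)ᶜ = 0 →
      charFun m t = (∫ x, cos (t * x) ∂m : ℝ) + (∫ x, sin (t * x) ∂m : ℝ) * Complex.I := by
    intro m _ hm
    rw [charFun_apply_real, ← integral_complex_ofReal, ← integral_complex_ofReal,
      ← integral_mul_const, ← integral_add]
    · refine integral_congr_ae (Eventually.of_forall fun x => ?_)
      simp only
      rw [← Complex.ofReal_mul, Complex.exp_mul_I, Complex.ofReal_cos, Complex.ofReal_sin]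
    · exact (integrable_of_continuous hm hcos.continuous).ofReal
    · exact (integrable_of_continuous hm hsin.continuous).ofReal.mul_const _
  rw [key hμ, key hρ, hW hcos, hW hsin]

end

/-- A measure that satisfies the Euler-Lagrange conditions is the unique minimiser. -/
lemma isEquilibrium_of_potential {R : ℝ} {ρ : Measure ℝ} [IsProbabilityMeasure ρ] [NullSingletonClass ρ]
    (hR : 0 < R) (hρ : ρ (Icc (-R) R)ᶜ = 0) {V : ℝ → ℝ} (hV : Continuous V)
    (hint : Integrable (fun p : ℝ × ℝ => -log |p.1 - p.2|) (ρ.prod ρ)) {C : ℝ}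
    (hge : ∀ x ∈ Icc (-R) R, C ≤ V x + ∫ y, -log |x - y| ∂ρ)
    (heq : ∀ᵐ x ∂ρ, V x + ∫ y, -log |x - y| ∂ρ = C) :
    IsEquilibrium V (Icc (-R) R) ρ ∧ ∀ μ, IsEquilibrium V (Icc (-R) R) μ → μ = ρ := by
  have hmem : ρ ∈ probOn (Icc (-R) R) := ⟨inferInstance, hρ⟩
  refine ⟨⟨hmem, fun μ hμ => ?_⟩, fun μ hμ => ?_⟩
  · have := hμ.1
    by_cases he : energy V μ = ⊤
    · simp [he]
    · obtain ⟨e, e₀, h1, h2, hs, hle⟩ := energy_sub_ge hR hμ.2 hρ hV hint hge heq he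
      have hnn : 0 ≤ ∑' n : ℕ, 2 / (n : ℝ) * (chebMoment R μ n - chebMoment R ρ n) ^ 2 :=
        tsum_nonneg fun n => by positivity
      simp only [mem_ofPred_eq, h1, h2, EReal.coe_le_coe_iff]
      linarith
  · have hprob := hμ.1.1
    have hle : energy V μ ≤ energy V ρ := hμ.2 hmem
    have hfin : energy V ρ ≠ ⊤ := by
      rw [energy_eq_integral prod_diag_eq_zero ((integrable_pairEnergy_iff hρ hV).2 hint)]
      exact EReal.coe_ne_top _
    obtain ⟨e, e₀, h1, h2, hs, hle'⟩ :=
      energy_sub_ge hR hμ.1.2 hρ hV hint hge heq (ne_top_of_le_ne_top hfin hle)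
    rw [h1, h2, EReal.coe_le_coe_iff] at hle
    have hnn : ∀ n : ℕ, 0 ≤ 2 / (n : ℝ) * (chebMoment R μ n - chebMoment R ρ n) ^ 2 :=
      fun n => by positivity
    have hz : ∑' n : ℕ, 2 / (n : ℝ) * (chebMoment R μ n - chebMoment R ρ n) ^ 2 = 0 :=
      le_antisymm (by linarith) (tsum_nonneg hnn)
    refine eq_of_chebMoment_eq hR hμ.1.2 hρ fun n => ?_
    -- The weight 2 / n is 0 at n = 0 and gives no information there, but the moment of order 0 is
    -- the total mass.
    rcases Nat.eq_zero_or_pos n with rfl | hn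
    · simp [chebMoment, chebT]
    · have h0 := congrFun ((hasSum_zero_iff_of_nonneg hnn).1 (hz ▸ hs.hasSum)) n
      have hn' : (2 : ℝ) / n ≠ 0 := by
        have : (0 : ℝ) < n := by exact_mod_cast hn
        positivity
      have := pow_eq_zero_iff (two_ne_zero) |>.1 ((mul_eq_zero.1 h0).resolve_left hn')
      linarith

/-! ### Measures with an arcsine weight -/

/-- The measure with density `G(x) / (π √(R² - x²))` on `|x| < R`. -/
noncomputable def arcMeasure (G : ℝ → ℝ) (R : ℝ) : Measure ℝ :=
  volume.withDensity fun x => ENNReal.ofReal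
    ((Ioo (-R) R).indicator (fun x => 1 / π * (G x / √(R ^ 2 - x ^ 2))) x)

/-- The density `P_R` in closed form. -/
noncomputable def pushedDensity (V : ℝ → ℝ) (R x : ℝ) : ℝ :=
  1 - meanVirial V R + (R ^ 2 - x ^ 2) * meanSlope V R x

lemma pushedMeasure_eq_arcMeasure {V : ℝ → ℝ} (hV : ContDiff ℝ 3 V) (hsymm : ∀ x, V (-x) = V x)
    {R : ℝ} (hR : 0 < R) : pushedMeasure V R =
      arcMeasure (pushedDensity V R) R := by
  rw [pushedMeasure, arcMeasure]
  congr 1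
  ext x
  by_cases hx : x ∈ Ioo (-R) R
  · rw [indicator_of_mem hx, indicator_of_mem hx, pushedP_eq hV hsymm hR (Ioo_subset_Icc_self hx),
      pushedDensity]
  · rw [indicator_of_notMem hx, indicator_of_notMem hx]

lemma pulledMeasure_eq_arcMeasure (Q : ℝ → ℝ) (r : ℝ) :
    pulledMeasure Q r = arcMeasure (fun x => (r ^ 2 - x ^ 2) * Q x) r := by
  rw [pulledMeasure, arcMeasure]
  congr 1
  ext x
  by_cases hx : x ∈ Ioo (-r) r
  · rw [indicator_of_mem hx, indicator_of_mem (Ioo_subset_Icc_self hx)]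
    have hpos : 0 < r ^ 2 - x ^ 2 := by nlinarith [hx.1, hx.2]
    have := sq_sqrt hpos.le
    have h2 : √(r ^ 2 - x ^ 2) ≠ 0 := (sqrt_pos.2 hpos).ne'
    congr 2
    rw [eq_div_iff h2]
    linear_combination Q x * this
  · rw [indicator_of_notMem hx]
    -- Closed against open interval: at ±r both densities are 0.
    by_cases hx' : x ∈ Icc (-r) r
    · rw [indicator_of_mem hx']
      have : r ^ 2 - x ^ 2 = 0 := by
        have : x = r ∨ x = -r := by
          by_contra! h
          exact hx ⟨lt_of_le_of_ne hx'.1 (Ne.symm h.2), lt_of_le_of_ne hx'.2 h.1⟩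
        rcases this with rfl | rfl <;> ring
      simp [this]
    · rw [indicator_of_notMem hx']

lemma integrable_arcDensity {R : ℝ} (hR : 0 < R) :
    IntegrableOn (fun x => 1 / √(R ^ 2 - x ^ 2)) (Ioo (-R) R) := by
  have h := Polynomial.Chebyshev.intervalIntegrable_sqrt_one_sub_sq_inv.comp_mul_left (c := R⁻¹)
  rw [show -1 / R⁻¹ = -R by field_simp, show 1 / R⁻¹ = R by field_simp,
    intervalIntegrable_iff_integrableOn_Ioo_of_le (by linarith)] at h
  refine (h.const_mul R⁻¹).congr (Eventually.of_forall fun x => ?_)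
  have : √(R ^ 2 - x ^ 2) = R * √(1 - (R⁻¹ * x) ^ 2) := by
    rw [← sqrt_sq hR.le, ← sqrt_mul (sq_nonneg _), sqrt_sq hR.le]
    congr 1
    field_simp
  simp only [this, sqrt_inv]
  rw [one_div, mul_inv]

lemma integral_arcDensity {R : ℝ} (hR : 0 < R) (F : ℝ → ℝ) :
    ∫ x in Ioo (-R) R, F x * (1 / √(R ^ 2 - x ^ 2)) = ∫ θ in (0 : ℝ)..π, F (R * cos θ) := by
  have h := Polynomial.Chebyshev.integral_measureT (fun x => F (R * x))
  rw [Polynomial.Chebyshev.integral_measureT_eq_integral_cos] at h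
  rw [h, ← integral_Ioc_eq_integral_Ioo, ← intervalIntegral.integral_of_le (by linarith)]
  have h2 := intervalIntegral.smul_integral_comp_mul_left (a := -1) (b := 1)
    (fun x => F x * (1 / √(R ^ 2 - x ^ 2))) R
  rw [mul_neg, mul_one] at h2
  rw [← h2, smul_eq_mul, ← intervalIntegral.integral_const_mul]
  refine intervalIntegral.integral_congr fun x _ => ?_
  have : √(R ^ 2 - (R * x) ^ 2) = R * √(1 - x ^ 2) := by
    rw [← sqrt_sq hR.le, ← sqrt_mul (sq_nonneg _), sqrt_sq hR.le]
    congr 1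
    ring
  simp only [this, sqrt_inv]
  field_simp

section
variable {G : ℝ → ℝ} {R : ℝ}

lemma measurable_arcDensity (hG : Continuous G) :
    Measurable ((Ioo (-R) R).indicator (fun x => 1 / π * (G x / √(R ^ 2 - x ^ 2)))) := by
  have := hG.measurable
  exact Measurable.indicator (by fun_prop) measurableSet_Ioo

lemma integrable_mul_arcDensity (hG : Continuous G) (hR : 0 < R) :
    Integrable ((Ioo (-R) R).indicator (fun x => 1 / π * (G x / √(R ^ 2 - x ^ 2)))) := by
  rw [integrable_indicator_iff measurableSet_Ioo]
  obtain ⟨M, hM⟩ := (isCompact_Icc (a := -R) (b := R)).exists_bound_of_continuousOn hG.continuousOn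
  have h := (integrable_arcDensity hR).bdd_mul (f := fun x => 1 / π * G x) (c := 1 / π * M)
    (by fun_prop) ?_
  · refine h.congr (Eventually.of_forall fun x => ?_)
    simp only; ring
  · filter_upwards [ae_restrict_mem measurableSet_Ioo] with x hx
    rw [norm_mul, norm_of_nonneg (by positivity : (0 : ℝ) ≤ 1 / π)]
    exact mul_le_mul_of_nonneg_left (hM x (Ioo_subset_Icc_self hx)) (by positivity)

lemma arcDensity_nonneg (hG0 : ∀ x ∈ Icc (-R) R, 0 ≤ G x) (x : ℝ) :
    0 ≤ (Ioo (-R) R).indicator (fun x => 1 / π * (G x / √(R ^ 2 - x ^ 2))) x := by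
  refine indicator_nonneg (fun x hx => ?_) x
  have := hG0 x (Ioo_subset_Icc_self hx)
  positivity

lemma integral_arcMeasure (hG : Continuous G) (hG0 : ∀ x ∈ Icc (-R) R, 0 ≤ G x) (hR : 0 < R)
    (F : ℝ → ℝ) : ∫ x, F x ∂(arcMeasure G R) =
      1 / π * ∫ θ in (0 : ℝ)..π, G (R * cos θ) * F (R * cos θ) := by
  rw [arcMeasure, integral_withDensity_eq_integral_toReal_smul
    (measurable_arcDensity hG).ennreal_ofReal (by simp), ← integral_arcDensity hR (fun x => G x * F x),
    ← integral_indicator measurableSet_Ioo, ← integral_const_mul]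
  refine integral_congr_ae (Eventually.of_forall fun x => ?_)
  simp only
  rw [ENNReal.toReal_ofReal (arcDensity_nonneg hG0 x)]
  by_cases hx : x ∈ Ioo (-R) R
  · rw [indicator_of_mem hx, indicator_of_mem hx, smul_eq_mul]; ring
  · rw [indicator_of_notMem hx, indicator_of_notMem hx]; simp

lemma arcMeasure_compl : arcMeasure G R (Icc (-R) R)ᶜ = 0 := by
  rw [arcMeasure, withDensity_apply _ measurableSet_Icc.compl]
  refine (setLIntegral_congr_fun measurableSet_Icc.compl fun x hx => ?_).trans lintegral_zero
  have : x ∉ Ioo (-R) R := fun h => hx (Ioo_subset_Icc_self h)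
  simp only [indicator_of_notMem this, ENNReal.ofReal_zero]

instance : NullSingletonClass (arcMeasure G R) := by
  unfold arcMeasure; infer_instance

lemma isProbabilityMeasure_arcMeasure (hG : Continuous G) (hG0 : ∀ x ∈ Icc (-R) R, 0 ≤ G x)
    (hR : 0 < R) (hone : ∫ θ in (0 : ℝ)..π, G (R * cos θ) = π) :
    IsProbabilityMeasure (arcMeasure G R) := by
  constructor
  rw [arcMeasure, withDensity_apply _ MeasurableSet.univ, setLIntegral_univ,
    ← ofReal_integral_eq_lintegral_ofReal (integrable_mul_arcDensity hG hR)
      (Eventually.of_forall (arcDensity_nonneg hG0)), integral_indicator measurableSet_Ioo]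
  have := integral_arcDensity hR (fun x => 1 / π * G x)
  rw [intervalIntegral.integral_const_mul, hone, one_div, inv_mul_cancel₀ pi_ne_zero] at this
  rw [← ENNReal.ofReal_one]
  congr 1
  refine Eq.trans (integral_congr_ae (Eventually.of_forall fun x => ?_)) this
  simp only; ring

lemma support_arcMeasure (hG : Continuous G) (hR : 0 < R) (hpos : ∀ x ∈ Ioo (-R) R, 0 < G x) :
    (arcMeasure G R).support = Icc (-R) R := by
  refine Subset.antisymm ?_ ?_
  · exact Measure.support_subset_of_isClosed isClosed_Icc (mem_ae_iff.2 arcMeasure_compl)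
  · rw [← closure_Ioo (by linarith : -R ≠ R)]
    refine closure_minimal (fun x hx => ?_) Measure.isClosed_support
    rw [Measure.mem_support_iff_forall]
    intro U hU
    have hU' : U ∩ Ioo (-R) R ∈ 𝓝 x := inter_mem hU (isOpen_Ioo.mem_nhds hx)
    obtain ⟨W, hWU, hWo, hxW⟩ := mem_nhds_iff.1 hU'
    refine lt_of_lt_of_le ?_ (measure_mono (hWU.trans inter_subset_left))
    rw [pos_iff_ne_zero]
    intro h0
    rw [arcMeasure, withDensity_apply _ hWo.measurableSet] at h0
    have hm := (measurable_arcDensity (R := R) hG).ennreal_ofReal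
    have hp : ∀ y ∈ W, ENNReal.ofReal ((Ioo (-R) R).indicator
        (fun x => 1 / π * (G x / √(R ^ 2 - x ^ 2))) y) ≠ 0 := by
      intro y hy
      have hy' := (hWU hy).2
      rw [indicator_of_mem hy']
      have h1 := hpos y hy'
      have h2 : 0 < √(R ^ 2 - y ^ 2) := sqrt_pos.2 (by nlinarith [hy'.1, hy'.2])
      have : 0 < 1 / π * (G y / √(R ^ 2 - y ^ 2)) := by positivity
      simpa using this
    have h1 : ∀ᵐ y ∂(volume.restrict W), False := by
      filter_upwards [(lintegral_eq_zero_iff' hm.aemeasurable).1 h0, ae_restrict_mem hWo.measurableSet]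
        with y hy hyW using hp y hyW hy
    have h2 : volume W = 0 := by simpa using h1
    exact (hWo.measure_pos volume ⟨x, hxW⟩).ne' h2

end

/-! ### The pushed phase -/

section
variable {V : ℝ → ℝ} (hV : ContDiff ℝ 3 V)
include hV

lemma continuous_meanSlope_uncurry : Continuous fun p : ℝ × ℝ => meanSlope V p.1 p.2 := by
  obtain ⟨-, -, hc⟩ := deriv_facts hV
  unfold meanSlope
  refine continuous_const.mul
    (intervalIntegral.continuous_parametric_intervalIntegral_of_continuous' ?_ _ _)
  exact (continuous_divDiff hc).comp (by fun_prop :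
    Continuous fun q : (ℝ × ℝ) × ℝ => (q.1.2, q.1.1 * cos q.2))

lemma continuous_meanVirial : Continuous (meanVirial V) := by
  obtain ⟨hc, -, -⟩ := deriv_facts hV
  unfold meanVirial
  refine continuous_const.mul
    (intervalIntegral.continuous_parametric_intervalIntegral_of_continuous' ?_ _ _)
  fun_prop

lemma continuous_meanSlope (R : ℝ) : Continuous (meanSlope V R) :=
  (continuous_meanSlope_uncurry hV).comp (by fun_prop : Continuous fun x : ℝ => (R, x))

lemma continuous_pushedDensity (R : ℝ) : Continuous (pushedDensity V R) := by
  have := continuous_meanSlope hV R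
  unfold pushedDensity
  fun_prop

end

lemma integral_cos_mul_cos (n k : ℕ) : ∫ θ in (0 : ℝ)..π, cos (n * θ) * cos (k * θ) =
    if n = k then chebNorm k else 0 := by
  have h : ∫ θ in (0 : ℝ)..π, cos (n * θ) * cos (k * θ) =
      ∫ x, (Polynomial.Chebyshev.T ℝ n).eval x * (Polynomial.Chebyshev.T ℝ k).eval x
        ∂Polynomial.Chebyshev.measureT := by
    rw [Polynomial.Chebyshev.integral_measureT_eq_integral_cos]
    simp [Polynomial.Chebyshev.T_real_cos]
  rw [h]
  split_ifs with hnk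
  · subst hnk
    rw [chebNorm]
    split_ifs with h0
    · subst h0
      exact Polynomial.Chebyshev.integral_eval_T_real_mul_self_measureT_zero
    · exact Polynomial.Chebyshev.integral_T_real_mul_self_measureT_of_ne_zero h0
  · exact Polynomial.Chebyshev.integral_eval_T_real_mul_eval_T_real_measureT_of_ne hnk

section
variable {V : ℝ → ℝ} (hV : ContDiff ℝ 3 V) (hsymm : ∀ x, V (-x) = V x) {R : ℝ} (hR : 0 < R)
include hV hsymm hR

/-- Orthogonality applied termwise to P_R = 1 - Σ n c_n T_n, which converges uniformly. The case k =
0 gives total mass one, the others give the moments. -/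
lemma integral_pushedDensity_mul_cos (k : ℕ) :
    ∫ θ in (0 : ℝ)..π, pushedDensity V R (R * cos θ) * cos (k * θ) =
      if k = 0 then π else -(π / 2 * (k * chebCoeff V R k)) := by
  have hmem : ∀ θ, R * cos θ ∈ Icc (-R) R := fun θ =>
    ⟨by nlinarith [neg_one_le_cos θ], by nlinarith [cos_le_one θ]⟩
  have hsum : ∀ θ, HasSum (fun n : ℕ => (n : ℝ) * chebCoeff V R n * (cos (n * θ) * cos (k * θ)))
      ((1 - pushedDensity V R (R * cos θ)) * cos (k * θ)) := by
    intro θ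
    have h := (hasSum_nat_mul_chebCoeff hV hsymm hR (hmem θ)).mul_right (cos (k * θ))
    rw [mul_div_cancel_left₀ _ hR.ne'] at h
    simp only [chebT_cos, mul_assoc] at h ⊢
    have e : (1 - pushedDensity V R (R * cos θ)) =
        meanVirial V R - (R ^ 2 - (R * cos θ) ^ 2) * meanSlope V R (R * cos θ) := by
      rw [pushedDensity.eq_1]; ring
    rw [e]
    exact h
  have hs : Summable fun n : ℕ => |(n : ℝ) * chebCoeff V R n| := summable_abs_nat_mul_chebCoeff hV R
  have hint := intervalIntegral.hasSum_integral_of_dominated_convergence (μ := volume)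
    (a := 0) (b := π)
    (F := fun (n : ℕ) θ => (n : ℝ) * chebCoeff V R n * (cos (n * θ) * cos (k * θ)))
    (fun n _ => |(n : ℝ) * chebCoeff V R n|) (fun n => by fun_prop)
    (fun n => Eventually.of_forall fun θ _ => by
      rw [norm_mul]
      refine mul_le_of_le_one_right (abs_nonneg _) ?_
      rw [norm_mul]
      exact mul_le_one₀ (abs_cos_le_one _) (norm_nonneg _) (abs_cos_le_one _))
    (Eventually.of_forall fun θ _ => hs) (by simp)
    (Eventually.of_forall fun θ _ => hsum θ)
  simp only [intervalIntegral.integral_const_mul, integral_cos_mul_cos] at hint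
  have h1 := hint.unique (hasSum_single k fun n hn => by rw [if_neg hn, mul_zero])
  rw [if_pos rfl] at h1
  have hc := continuous_pushedDensity hV R
  simp only [sub_mul, one_mul] at h1
  rw [intervalIntegral.integral_sub (Continuous.intervalIntegrable (by fun_prop) _ _)
    (Continuous.intervalIntegrable (by fun_prop) _ _)] at h1
  have h0 : ∫ θ in (0 : ℝ)..π, cos (k * θ) = if k = 0 then π else 0 := by
    split_ifs with hk
    · simp [hk]
    · exact integral_cos_nat_mul hk
  rw [h0] at h1
  split_ifs at h1 ⊢ with hk
  · subst hk
    simp at h1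
    simp
    linarith
  · rw [chebNorm, if_neg hk] at h1
    linarith

variable (hnn : ∀ x ∈ Icc (-R) R, 0 ≤ pushedDensity V R x)
include hnn

lemma isProbabilityMeasure_pushed : IsProbabilityMeasure (arcMeasure (pushedDensity V R) R) := by
  refine isProbabilityMeasure_arcMeasure (continuous_pushedDensity hV R) hnn hR ?_
  simpa using integral_pushedDensity_mul_cos hV hsymm hR 0

lemma chebMoment_pushed {n : ℕ} (hn : n ≠ 0) :
    chebMoment R (arcMeasure (pushedDensity V R) R) n = -(n * chebCoeff V R n / 2) := by
  rw [chebMoment, integral_arcMeasure (continuous_pushedDensity hV R) hnn hR]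
  simp only [mul_div_cancel_left₀ _ hR.ne', chebT_cos]
  rw [integral_pushedDensity_mul_cos hV hsymm hR, if_neg hn]
  field_simp

/-- The weight 2 / n of the kernel cancels the factor n in P_R. What remains are the coefficients of
-V without the constant one, so the potential cancels V up to a constant. -/
lemma two_div_mul_chebMoment_pushed (n : ℕ) :
    2 / (n : ℝ) * chebMoment R (arcMeasure (pushedDensity V R) R) n =
      if n = 0 then 0 else -chebCoeff V R n := by
  split_ifs with hn
  · simp [hn]
  · rw [chebMoment_pushed hV hsymm hR hnn hn]
    field_simp

/-- The potential of the pushed measure. -/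
lemma potential_pushed {x : ℝ} (hx : x ∈ Icc (-R) R) :
    Integrable (fun y => -log |x - y|) (arcMeasure (pushedDensity V R) R) ∧
    V x + ∫ y, -log |x - y| ∂(arcMeasure (pushedDensity V R) R) =
      log 2 - log R + chebCoeff V R 0 := by
  set ρ := arcMeasure (pushedDensity V R) R with hρ
  have hprob : IsProbabilityMeasure ρ := isProbabilityMeasure_pushed hV hsymm hR hnn
  -- Taking a Dirac mass at x as the first factor gives the potential at every point of [-R, R], not
  -- only almost everywhere.
  have hdir : Measure.dirac x (Icc (-R) R)ᶜ = 0 := by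
    rw [Measure.dirac_apply' _ measurableSet_Icc.compl]
    simpa using hx
  have hm : ∀ n : ℕ, 2 / (n : ℝ) * ∫ p, chebT n (p.1 / R) * chebT n (p.2 / R)
      ∂((Measure.dirac x).prod ρ) =
      if n = 0 then 0 else -(chebCoeff V R n * chebT n (x / R)) := by
    intro n
    rw [integral_prod_chebT, chebMoment, integral_dirac, mul_left_comm,
      two_div_mul_chebMoment_pushed hV hsymm hR hnn]
    split_ifs <;> ring
  have hs := summable_mul_of_abs_le_one (summable_abs_chebCoeff hV R)
    fun n => abs_chebT_div_le_one hR hx n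
  have habs : Summable fun n : ℕ => |chebCoeff V R n * chebT n (x / R)| := by
    refine Summable.of_nonneg_of_le (fun _ => abs_nonneg _) (fun n => ?_) (summable_abs_chebCoeff hV R)
    rw [abs_mul]
    exact mul_le_of_le_one_right (abs_nonneg _) (abs_chebT_div_le_one hR hx n)
  obtain ⟨hi, heq⟩ := integral_neg_log_eq_tsum hR (prod_compl_square hdir (hρ ▸ arcMeasure_compl : ρ (Icc (-R) R)ᶜ = 0))
    (prod_diag_eq_zero (μ := Measure.dirac x) (ρ := ρ)) (by
      simp only [hm]
      refine Summable.of_nonneg_of_le (fun _ => abs_nonneg _) (fun n => ?_) habs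
      split_ifs
      · rw [abs_zero]; exact abs_nonneg _
      · rw [abs_neg])
  have hmk : Measurable (Prod.mk x : ℝ → ℝ × ℝ) := measurable_prodMk_left
  have hmeas : Measurable fun p : ℝ × ℝ => -log |p.1 - p.2| := by fun_prop
  rw [Measure.dirac_prod] at hi heq
  rw [integrable_map_measure hmeas.aestronglyMeasurable hmk.aemeasurable] at hi
  refine ⟨hi, ?_⟩
  rw [integral_map hmk.aemeasurable hmeas.aestronglyMeasurable] at heq
  rw [heq]
  rw [Measure.dirac_prod] at hm
  simp only [hm]
  have hV0 := hasSum_chebCoeff hV hR hx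
  have h1 := (hV0.sub (hasSum_ite_eq 0 (chebCoeff V R 0))).neg
  have h2 : (fun n : ℕ => -(chebCoeff V R n * chebT n (x / R) -
      if n = 0 then chebCoeff V R 0 else 0)) =
      fun n => if n = 0 then 0 else -(chebCoeff V R n * chebT n (x / R)) := by
    ext n
    split_ifs with hn
    · subst hn; simp [chebT]
    · ring
  rw [h2] at h1
  rw [h1.tsum_eq]
  ring

/-- For n ≥ 1 the self-energy terms are n c_n² / 2, dominated by a multiple of |n c_n|. -/
lemma integrable_neg_log_pushed :
    Integrable (fun p : ℝ × ℝ => -log |p.1 - p.2|)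
      ((arcMeasure (pushedDensity V R) R).prod (arcMeasure (pushedDensity V R) R)) := by
  have hprob : IsProbabilityMeasure (arcMeasure (pushedDensity V R) R) :=
    isProbabilityMeasure_pushed hV hsymm hR hnn
  have hs : Summable fun n : ℕ =>
      2 / (n : ℝ) * chebMoment R (arcMeasure (pushedDensity V R) R) n ^ 2 := by
    obtain ⟨M, hM⟩ := exists_nat_mul_chebCoeff_le hV R
    refine Summable.of_nonneg_of_le (fun _ => by positivity) (fun n => ?_)
      (((summable_abs_nat_mul_chebCoeff hV R).mul_left |M|))
    rcases Nat.eq_zero_or_pos n with rfl | hn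
    · simp
    have hn1 : (1 : ℝ) ≤ n := by exact_mod_cast hn
    rw [pow_two, ← mul_assoc, two_div_mul_chebMoment_pushed hV hsymm hR hnn, if_neg hn.ne',
      chebMoment_pushed hV hsymm hR hnn hn.ne']
    have h1 : |(n : ℝ) * chebCoeff V R n| ≤ |M| := by
      refine (hM n).trans ?_
      refine (le_abs_self _).trans ?_
      rw [abs_mul]
      refine mul_le_of_le_one_right (abs_nonneg _) ?_
      rw [abs_of_nonneg (by positivity), div_le_one (by positivity)]
      nlinarith
    have h2 : |chebCoeff V R n| ≤ |(n : ℝ) * chebCoeff V R n| := by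
      rw [abs_mul, Nat.abs_cast]
      exact le_mul_of_one_le_left (abs_nonneg _) hn1
    calc -chebCoeff V R n * -(n * chebCoeff V R n / 2)
        = 1 / 2 * (chebCoeff V R n * (n * chebCoeff V R n)) := by ring
      _ ≤ 1 / 2 * (|chebCoeff V R n| * |n * chebCoeff V R n|) := by
          rw [← abs_mul]; exact mul_le_mul_of_nonneg_left (le_abs_self _) (by norm_num)
      _ ≤ 1 / 2 * (|M| * |n * chebCoeff V R n|) := by
          have := h2.trans h1
          gcongr
      _ ≤ |M| * |n * chebCoeff V R n| := by
          have := mul_nonneg (abs_nonneg M) (abs_nonneg (n * chebCoeff V R n))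
          linarith
  exact (integral_neg_log_prod_eq hR arcMeasure_compl arcMeasure_compl hs hs).2.1

/-- The pushed phase. -/
lemma isEquilibrium_pushed : IsEquilibrium V (Icc (-R) R) (arcMeasure (pushedDensity V R) R) ∧
    ∀ μ, IsEquilibrium V (Icc (-R) R) μ → μ = arcMeasure (pushedDensity V R) R := by
  have hprob : IsProbabilityMeasure (arcMeasure (pushedDensity V R) R) :=
    isProbabilityMeasure_pushed hV hsymm hR hnn
  refine isEquilibrium_of_potential hR arcMeasure_compl hV.continuous
    (integrable_neg_log_pushed hV hsymm hR hnn)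
    (fun x hx => (potential_pushed hV hsymm hR hnn hx).2.ge) ?_
  filter_upwards [show ∀ᵐ x ∂(arcMeasure (pushedDensity V R) R), x ∈ Icc (-R) R from
    mem_ae_iff.2 arcMeasure_compl] with x hx using (potential_pushed hV hsymm hR hnn hx).2

end

/-! ### Consequences of convexity: signs, critical radius, growth -/

section
variable {V : ℝ → ℝ} (hV : ContDiff ℝ 3 V) (hconv : StrictConvexOn ℝ univ V)
include hV hconv

lemma strictMono_deriv : StrictMono (deriv V) := by
  rw [← strictMonoOn_univ]
  exact hconv.strictMonoOn_deriv fun x _ => hV.differentiable (by norm_num) x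

lemma divDiff_nonneg (x y : ℝ) : 0 ≤ divDiff (deriv (deriv V)) x y := by
  refine intervalIntegral.integral_nonneg zero_le_one fun t _ => ?_
  exact (strictMono_deriv hV hconv).monotone.deriv_nonneg

/-- V'' may vanish at some points, but V' is strictly increasing, so its difference quotients are
positive. -/
lemma divDiff_pos {x y : ℝ} (hxy : x ≠ y) : 0 < divDiff (deriv (deriv V)) x y := by
  refine lt_of_le_of_ne (divDiff_nonneg hV hconv x y) fun h => hxy ?_
  obtain ⟨-, hd, hc⟩ := deriv_facts hV
  have := sub_mul_divDiff hd hc x y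
  rw [← h, mul_zero] at this
  exact (strictMono_deriv hV hconv).injective (by linarith)

lemma meanSlope_pos {R : ℝ} (hR : 0 < R) (x : ℝ) : 0 < meanSlope V R x := by
  obtain ⟨-, hd, hc⟩ := deriv_facts hV
  have hDc : Continuous fun φ => divDiff (deriv (deriv V)) x (R * cos φ) :=
    (continuous_divDiff hc).comp (continuous_const.prodMk (by fun_prop))
  refine mul_pos (by positivity) (intervalIntegral.integral_pos pi_pos hDc.continuousOn
    (fun φ _ => divDiff_nonneg hV hconv _ _) ?_)
  -- One φ with a positive integrand is enough, and x cannot equal both R and -R.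
  by_cases h : x = R
  · refine ⟨π, ⟨pi_pos.le, le_rfl⟩, divDiff_pos hV hconv ?_⟩
    rw [cos_pi, h]; intro h; linarith
  · refine ⟨0, ⟨le_rfl, pi_pos.le⟩, divDiff_pos hV hconv ?_⟩
    simpa using h

lemma tangent_le (x : ℝ) : V 1 + deriv V 1 * (x - 1) ≤ V x := by
  have hd := hV.differentiable (by norm_num) 1
  rcases lt_trichotomy x 1 with h | rfl | h
  · have := hconv.convexOn.slope_le_deriv (mem_univ x) (mem_univ 1) h hd
    rw [slope_def_field, div_le_iff₀ (by linarith)] at this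
    linarith
  · simp
  · have := hconv.convexOn.deriv_le_slope (mem_univ 1) (mem_univ x) h hd
    rw [slope_def_field, le_div_iff₀ (by linarith)] at this
    linarith

variable (hsymm : ∀ x, V (-x) = V x)
include hsymm

omit hV hconv in
lemma deriv_zero_of_even : deriv V 0 = 0 := by
  have := deriv_neg_of_even hsymm 0
  rw [neg_zero] at this
  linarith

lemma deriv_one_pos : 0 < deriv V 1 := by
  rw [← deriv_zero_of_even hsymm]
  exact strictMono_deriv hV hconv one_pos

lemma le_mul_deriv (y : ℝ) : deriv V 1 * (|y| - 1) ≤ y * deriv V y := by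
  have hm := (strictMono_deriv hV hconv).monotone
  have h1 := deriv_one_pos hV hconv hsymm
  have key : ∀ z, 0 ≤ z → deriv V 1 * (z - 1) ≤ z * deriv V z := by
    intro z hz
    rcases le_total z 1 with h | h
    · have h2 : 0 ≤ deriv V z := by rw [← deriv_zero_of_even hsymm]; exact hm hz
      nlinarith [mul_nonneg hz h2]
    · nlinarith [hm h, mul_le_mul_of_nonneg_left (hm h) hz]
  rcases le_total 0 y with h | h
  · rw [abs_of_nonneg h]; exact key y h
  · rw [abs_of_nonpos h]
    have := key (-y) (by linarith)
    rwa [deriv_neg_of_even hsymm, neg_mul_neg] at this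

/-- Arcsine mean of `le_mul_deriv`; |cos| is replaced by the smaller cos², whose mean is 1/2. -/
lemma le_meanVirial {R : ℝ} (hR : 0 ≤ R) : deriv V 1 * (R / 2 - 1) ≤ meanVirial V R := by
  obtain ⟨hc, -, -⟩ := deriv_facts hV
  have h1 := deriv_one_pos hV hconv hsymm
  have : ∫ φ in (0 : ℝ)..π, (deriv V 1 * (R * cos φ ^ 2 - 1)) ≤
      ∫ φ in (0 : ℝ)..π, R * cos φ * deriv V (R * cos φ) := by
    refine intervalIntegral.integral_mono_on pi_pos.le
      (Continuous.intervalIntegrable (by fun_prop) _ _)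
      (Continuous.intervalIntegrable (by fun_prop) _ _) fun φ _ => ?_
    refine le_trans ?_ (le_mul_deriv hV hconv hsymm _)
    refine mul_le_mul_of_nonneg_left ?_ h1.le
    rw [abs_mul, abs_of_nonneg hR, ← sq_abs]
    have := abs_cos_le_one φ
    have h0 := abs_nonneg (cos φ)
    nlinarith [mul_le_of_le_one_left h0 this]
  have e : ∫ φ in (0 : ℝ)..π, (deriv V 1 * (R * cos φ ^ 2 - 1)) = π * (deriv V 1 * (R / 2 - 1)) := by
    rw [intervalIntegral.integral_const_mul, intervalIntegral.integral_sub
      (Continuous.intervalIntegrable (by fun_prop) _ _) (by simp),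
      intervalIntegral.integral_const_mul, integral_cos_sq]
    simp
    ring
  rw [e] at this
  rw [meanVirial, one_div, ← div_eq_inv_mul, le_div_iff₀ pi_pos]
  linarith

/-- The critical radius. -/
lemma exists_critical_radius : ∃ r : ℝ, IsLeast {R : ℝ | 0 < R ∧ meanVirial V R = 1} r ∧
    ∀ R, 0 < R → R < r → meanVirial V R < 1 := by
  have hc := continuous_meanVirial hV
  have h0 : meanVirial V 0 = 0 := by simp [meanVirial]
  have h1 := deriv_one_pos hV hconv hsymm
  -- The solution of V'(1) (M / 2 - 1) = 1, so that `le_meanVirial` gives S(M) ≥ 1.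
  set M := 2 * (1 + 1 / deriv V 1) with hM
  have hM0 : 0 ≤ M := by positivity
  have hSM : 1 ≤ meanVirial V M := by
    refine le_trans (le_of_eq ?_) (le_meanVirial hV hconv hsymm hM0)
    rw [hM]; field_simp; ring
  have ivt : ∀ b, 0 ≤ b → 1 ≤ meanVirial V b → ∃ R ∈ Icc 0 b, meanVirial V R = 1 := by
    intro b hb h
    exact intermediate_value_Icc hb hc.continuousOn ⟨by rw [h0]; exact zero_le_one, h⟩
  have hK : IsCompact (Icc 0 M ∩ meanVirial V ⁻¹' {1}) :=
    isCompact_Icc.inter_right (isClosed_singleton.preimage hc)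
  obtain ⟨R₁, hR₁, hR₁'⟩ := ivt M hM0 hSM
  obtain ⟨r, hr, hmin⟩ := hK.exists_isLeast ⟨R₁, hR₁, hR₁'⟩
  have hr1 : meanVirial V r = 1 := hr.2
  have hr0 : 0 < r := lt_of_le_of_ne hr.1.1 fun h => by rw [← h, h0] at hr1; norm_num at hr1
  have hmin' : ∀ R, 0 < R → meanVirial V R = 1 → r ≤ R := by
    intro R hR h
    by_contra! hlt
    exact hlt.not_ge (hmin ⟨⟨hR.le, hlt.le.trans hr.1.2⟩, h⟩)
  refine ⟨r, ⟨⟨hr0, hr1⟩, fun R hR => hmin' R hR.1 hR.2⟩, fun R hR hlt => ?_⟩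
  by_contra! h
  obtain ⟨R', hR', h'⟩ := ivt R hR.le h
  have : 0 < R' := lt_of_le_of_ne hR'.1 fun h => by rw [← h, h0] at h'; norm_num at h'
  -- A value S(R) ≥ 1 with R < r would produce a root R' ≤ R, against the minimality of r.
  linarith [hmin' R' this h', hR'.2]

/-- Growth of the potential. -/
lemma exists_log_le_potential : ∃ M : ℝ, ∀ x, log (1 + |x|) - M ≤ V x := by
  have h1 := deriv_one_pos hV hconv hsymm
  -- The tangent at 1, combined with log t ≤ t - 1 at t = V'(1) (1 + |x|).
  refine ⟨2 * deriv V 1 - 1 - log (deriv V 1) - V 1, fun x => ?_⟩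
  have habs : V |x| = V x := by
    rcases abs_choice x with h | h
    · rw [h]
    · rw [h, hsymm]
  have h2 := tangent_le hV hconv |x|
  have h3 := log_le_sub_one_of_pos (show 0 < deriv V 1 * (1 + |x|) by positivity)
  rw [log_mul h1.ne' (by positivity)] at h3
  rw [← habs]
  linarith

/-- From |x - y| ≤ (1 + |x|) (1 + |y|): the logarithmic repulsion is dominated by V, so the energy
on the whole line is bounded below. -/
lemma exists_le_pairEnergy : ∃ M : ℝ, ∀ p : ℝ × ℝ, p.1 ≠ p.2 → -M ≤ pairEnergy V p := by
  obtain ⟨M, hM⟩ := exists_log_le_potential hV hconv hsymm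
  refine ⟨M, fun p hp => ?_⟩
  have h1 := hM p.1
  have h2 := hM p.2
  have hpos : 0 < |p.1 - p.2| := abs_pos.2 (sub_ne_zero.2 hp)
  have h3 : log |p.1 - p.2| ≤ log ((1 + |p.1|) * (1 + |p.2|)) := by
    refine log_le_log hpos ((abs_sub _ _).trans ?_)
    nlinarith [abs_nonneg p.1, abs_nonneg p.2, mul_nonneg (abs_nonneg p.1) (abs_nonneg p.2)]
  rw [log_mul (by positivity) (by positivity)] at h3
  unfold pairEnergy
  linarith

end

/-! ### From intervals to the whole line -/

section
variable {V : ℝ → ℝ} (hV : Continuous V) {ρ : Measure ℝ}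

/-- Compare ρ with μ restricted to [-R, R] and renormalised. Subtracting e₀ inside the integral
makes the normalising factor irrelevant, so the inequality also covers a null restriction and passes
to the limit R → ∞. -/
lemma setIntegral_pairEnergy_ge {R : ℝ} {e₀ : ℝ} (he₀ : energy V ρ = e₀)
    (hmin : IsEquilibrium V (Icc (-R) R) ρ) {μ : Measure ℝ} [IsProbabilityMeasure μ]
    (hdiag : μ.prod μ {p | p.1 = p.2} = 0) (hint : Integrable (pairEnergy V) (μ.prod μ)) :
    0 ≤ ∫ p in square R, (pairEnergy V p - e₀) ∂(μ.prod μ) := by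
  set B := Icc (-R) R with hB
  have hrest : (μ.prod μ).restrict (square R) = (μ.restrict B).prod (μ.restrict B) := by
    rw [square, Measure.prod_restrict]
  by_cases h0 : μ B = 0
  · rw [hrest, Measure.restrict_eq_zero.2 h0]
    simp
  set c : ENNReal := (μ B)⁻¹ with hc
  have hc0 : c ≠ 0 := ENNReal.inv_ne_zero.2 (measure_ne_top μ B)
  have hct : c ≠ ⊤ := ENNReal.inv_ne_top.2 h0
  set m : Measure ℝ := c • μ.restrict B with hm
  have hmp : IsProbabilityMeasure m := ⟨by
    rw [hm, Measure.smul_apply, Measure.restrict_apply_univ, smul_eq_mul, hc,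
      ENNReal.inv_mul_cancel h0 (measure_ne_top μ B)]⟩
  have hmem : m ∈ probOn B := ⟨hmp, by
    rw [hm, Measure.smul_apply, Measure.restrict_apply measurableSet_Icc.compl, compl_inter_self]
    simp⟩
  have hprod : m.prod m = (c * c) • (μ.prod μ).restrict (square R) := by
    rw [hrest, hm, Measure.prod_smul_left, Measure.prod_smul_right, smul_smul]
  have hd : m.prod m {p | p.1 = p.2} = 0 := by
    rw [hprod, Measure.smul_apply]
    have := Measure.restrict_le_self (μ := μ.prod μ) (s := square R) {p : ℝ × ℝ | p.1 = p.2}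
    rw [hdiag, nonpos_iff_eq_zero] at this
    rw [this, smul_zero]
  have hi : Integrable (pairEnergy V) (m.prod m) := by
    rw [hprod]
    exact hint.restrict.smul_measure (ENNReal.mul_ne_top hct hct)
  have hle : energy V ρ ≤ energy V m := hmin.2 hmem
  rw [energy_eq_integral hd hi, he₀, EReal.coe_le_coe_iff] at hle
  have h1 : 0 ≤ ∫ p, (pairEnergy V p - e₀) ∂(m.prod m) := by
    rw [integral_sub hi (integrable_const _)]
    simpa using hle
  rw [hprod, integral_smul_measure, smul_eq_mul] at h1
  refine nonneg_of_mul_nonneg_right h1 ?_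
  exact ENNReal.toReal_pos (mul_ne_zero hc0 hc0) (ENNReal.mul_ne_top hct hct)

include hV in
/-- A measure that is a minimiser on all large intervals is a minimiser on the line. -/
lemma isEquilibrium_univ {r : ℝ} {e₀ : ℝ} (he₀ : energy V ρ = e₀)
    (hmin : ∀ R, r ≤ R → 0 < R → IsEquilibrium V (Icc (-R) R) ρ) {M : ℝ}
    (hM : ∀ p : ℝ × ℝ, p.1 ≠ p.2 → -M ≤ pairEnergy V p) : IsEquilibrium V univ ρ := by
  have hprob := (hmin (max r 1) (le_max_left _ _) (lt_max_of_lt_right one_pos)).1.1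
  refine ⟨⟨hprob, by simp⟩, fun μ hμ => ?_⟩
  have := hμ.1
  change energy V ρ ≤ energy V μ
  by_cases he : energy V μ = ⊤
  · simp [he]
  obtain ⟨hd, hi⟩ := integrable_pairEnergy_of_energy_ne_top hV (Eventually.of_forall hM) he
  rw [he₀, energy_eq_integral hd hi, EReal.coe_le_coe_iff]
  have hmono : Monotone fun k : ℕ => square (k : ℝ) := by
    intro j k hjk
    have : (j : ℝ) ≤ k := by exact_mod_cast hjk
    exact prod_mono (Icc_subset_Icc (by linarith) this) (Icc_subset_Icc (by linarith) this)
  have hU : ⋃ k : ℕ, square (k : ℝ) = univ := by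
    refine eq_univ_of_forall fun p => mem_iUnion.2 ?_
    obtain ⟨k, hk⟩ := exists_nat_ge (max |p.1| |p.2|)
    exact ⟨k, ⟨abs_le.1 ((le_max_left _ _).trans hk), abs_le.1 ((le_max_right _ _).trans hk)⟩⟩
  have hi' : Integrable (fun p => pairEnergy V p - e₀) (μ.prod μ) := hi.sub (integrable_const _)
  have ht := tendsto_setIntegral_of_monotone (μ := μ.prod μ) (f := fun p => pairEnergy V p - e₀)
    (fun k : ℕ => (isCompact_square (k : ℝ)).measurableSet) hmono hi'.integrableOn
  rw [hU, setIntegral_univ, integral_sub hi (integrable_const _)] at ht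
  have := ge_of_tendsto ht (b := 0) (by
    filter_upwards [eventually_ge_atTop (⌈max r 1⌉₊)] with k hk
    have hk' : max r 1 ≤ k := (Nat.le_ceil _).trans (by exact_mod_cast hk)
    exact setIntegral_pairEnergy_ge he₀ (hmin k ((le_max_left _ _).trans hk')
      (lt_of_lt_of_le one_pos ((le_max_right _ _).trans hk'))) hd hi)
  simpa using this

end

/-! ### The pulled phase: the effective potential outside the critical interval -/

lemma integral_comp_neg_cos (f : ℝ → ℝ) :
    ∫ φ in (0 : ℝ)..π, f (-cos φ) = ∫ φ in (0 : ℝ)..π, f (cos φ) := by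
  have h := intervalIntegral.integral_comp_sub_left (a := 0) (b := π) (fun φ => f (cos φ)) π
  simpa only [cos_pi_sub, sub_self, sub_zero] using h

lemma meanSlope_neg {V : ℝ → ℝ} (hsymm : ∀ x, V (-x) = V x) (R x : ℝ) :
    meanSlope V R (-x) = meanSlope V R x := by
  have h2 : ∀ z, deriv (deriv V) (-z) = deriv (deriv V) z := by
    intro z
    have h := deriv_comp_neg (deriv V) z
    rw [show (fun y => deriv V (-y)) = fun y => -deriv V y from
      funext (deriv_neg_of_even hsymm), deriv.fun_neg] at h
    linarith
  have h3 : ∀ y, divDiff (deriv (deriv V)) (-x) (-y) = divDiff (deriv (deriv V)) x y := by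
    intro y
    refine intervalIntegral.integral_congr fun t _ => ?_
    rw [← h2]
    ring_nf
  rw [meanSlope, meanSlope, ← integral_comp_neg_cos (fun z => divDiff (deriv (deriv V)) (-x) (R * z))]
  simp only [mul_neg, h3]

lemma pushedDensity_neg {V : ℝ → ℝ} (hsymm : ∀ x, V (-x) = V x) (R x : ℝ) :
    pushedDensity V R (-x) = pushedDensity V R x := by
  rw [pushedDensity, pushedDensity, meanSlope_neg hsymm, neg_sq]

/-- For h < s this is concavity of the logarithm. For s < h the argument (h² - s²) / s² is at most
(√h / √s)⁴; writing it as a fourth power before using log t ≤ t - 1 leaves only a singularity 1 /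
√s, which a square-root density compensates. -/
lemma log_second_difference_le {s h : ℝ} (hs : 0 < s) (hh : 0 < h) (hsh : s ≠ h) :
    log (s + h) + log |s - h| - 2 * log s ≤ if s < h then 4 * √h / √s else 0 := by
  have h1 : 0 < |s - h| := abs_pos.2 (sub_ne_zero.2 hsh)
  have e : log (s + h) + log |s - h| - 2 * log s = log ((s + h) * |s - h| / s ^ 2) := by
    rw [log_div (by positivity) (by positivity), log_mul (by positivity) h1.ne', log_pow]
    push_cast; ring
  rw [e]
  split_ifs with hlt
  · rw [abs_of_neg (by linarith)]
    have h2 : (s + h) * -(s - h) / s ^ 2 ≤ (√h / √s) ^ 4 := by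
      have : (√h / √s) ^ 4 = h ^ 2 / s ^ 2 := by
        rw [div_pow, show √h ^ 4 = (√h ^ 2) ^ 2 by ring, show √s ^ 4 = (√s ^ 2) ^ 2 by ring,
          sq_sqrt hh.le, sq_sqrt hs.le]
      rw [this]
      gcongr
      nlinarith
    have hpos : 0 < √h / √s := div_pos (sqrt_pos.2 hh) (sqrt_pos.2 hs)
    have h3 : 0 < (s + h) * -(s - h) / s ^ 2 :=
      div_pos (mul_pos (by linarith) (by linarith)) (by positivity)
    have h4 := log_le_log h3 h2
    rw [log_pow] at h4
    have h5 := log_le_sub_one_of_pos hpos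
    push_cast at h4
    have e4 : 4 * √h / √s = 4 * (√h / √s) := by ring
    linarith
  · have hlt' : h < s := lt_of_le_of_ne (not_lt.1 hlt) (Ne.symm hsh)
    rw [abs_of_pos (by linarith)]
    refine log_nonpos (div_nonneg (mul_nonneg (by linarith) (by linarith)) (by positivity)) ?_
    rw [div_le_one (by positivity)]
    nlinarith

section
variable {V : ℝ → ℝ} (hV : ContDiff ℝ 3 V) (hsymm : ∀ x, V (-x) = V x)
  (hconv : StrictConvexOn ℝ univ V) {r : ℝ} (hr : 0 < r) (hS : meanVirial V r = 1)

include hS in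
lemma pushedDensity_critical (x : ℝ) : pushedDensity V r x = (r ^ 2 - x ^ 2) * meanSlope V r x := by
  rw [pushedDensity, hS]; ring

include hV hconv hr hS in
lemma pushedDensity_critical_nonneg : ∀ x ∈ Icc (-r) r, 0 ≤ pushedDensity V r x := by
  intro x hx
  rw [pushedDensity_critical hS]
  exact mul_nonneg (by nlinarith [hx.1, hx.2]) (meanSlope_pos hV hconv hr x).le

include hV hr hS in
/-- The critical density vanishes like a square root at the edge. -/
lemma exists_critical_density_le : ∃ K : ℝ, 0 ≤ K ∧ ∀ x, (Ioo (-r) r).indicator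
    (fun x => 1 / π * (pushedDensity V r x / √(r ^ 2 - x ^ 2))) x ≤ K * √(r - x) := by
  obtain ⟨M, hM⟩ := (isCompact_Icc (a := -r) (b := r)).exists_bound_of_continuousOn
    (continuous_meanSlope hV r).continuousOn
  have hM0 : 0 ≤ M := (norm_nonneg _).trans (hM 0 ⟨by linarith, hr.le⟩)
  refine ⟨1 / π * M * √(2 * r), by positivity, fun x => ?_⟩
  by_cases hx : x ∈ Ioo (-r) r
  · rw [indicator_of_mem hx, pushedDensity_critical hS]
    have hpos : 0 < r ^ 2 - x ^ 2 := by nlinarith [hx.1, hx.2]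
    have h1 : (r ^ 2 - x ^ 2) * meanSlope V r x / √(r ^ 2 - x ^ 2) =
        meanSlope V r x * √(r ^ 2 - x ^ 2) := by
      rw [div_eq_iff (sqrt_pos.2 hpos).ne', mul_assoc, mul_self_sqrt hpos.le, mul_comm]
    have h2 : √(r ^ 2 - x ^ 2) ≤ √(2 * r) * √(r - x) := by
      rw [← sqrt_mul (by linarith)]
      refine sqrt_le_sqrt ?_
      nlinarith [hx.1, hx.2]
    have h3 : meanSlope V r x ≤ M := (le_abs_self _).trans (hM x (Ioo_subset_Icc_self hx))
    rw [h1]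
    calc 1 / π * (meanSlope V r x * √(r ^ 2 - x ^ 2))
        ≤ 1 / π * (M * (√(2 * r) * √(r - x))) := by gcongr
      _ = _ := by ring
  · rw [indicator_of_notMem hx]
    positivity

include hV hsymm hconv hr hS

/-- The logarithm is integrable for the critical measure. -/
lemma integrable_log_critical (x : ℝ) :
    Integrable (fun y => -log |x - y|) (arcMeasure (pushedDensity V r) r) := by
  have hnn := pushedDensity_critical_nonneg hV hconv hr hS
  have := isProbabilityMeasure_pushed hV hsymm hr hnn
  by_cases hx : x ∈ Icc (-r) r
  · exact (potential_pushed hV hsymm hr hnn hx).1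
  · refine integrable_of_continuousOn_of_compl_null isCompact_Icc arcMeasure_compl ?_
    refine ContinuousOn.neg (ContinuousOn.log (by fun_prop) fun y hy => ?_)
    exact abs_ne_zero.2 (sub_ne_zero.2 fun h => hx (h ▸ hy))

/-- Only points within h of the edge contribute to the upper bound. There the density is at most K
√(r - y), so the integrand is at most 4 K √h on an interval of length h. The result h^(3/2) is o(h),
which is all that is needed. -/
lemma exists_second_difference_potential_le : ∃ K : ℝ, ∀ h : ℝ, 0 < h →
    -(K * (h * √h)) ≤ ∫ y, -log |(r + h) - y| ∂(arcMeasure (pushedDensity V r) r)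
      + ∫ y, -log |(r - h) - y| ∂(arcMeasure (pushedDensity V r) r)
      - 2 * ∫ y, -log |r - y| ∂(arcMeasure (pushedDensity V r) r) := by
  obtain ⟨K, hK0, hK⟩ := exists_critical_density_le hV hr hS
  have hnn := pushedDensity_critical_nonneg hV hconv hr hS
  have hG := continuous_pushedDensity hV r
  set ρ := arcMeasure (pushedDensity V r) r with hρ
  set d := (Ioo (-r) r).indicator
    (fun x => 1 / π * (pushedDensity V r x / √(r ^ 2 - x ^ 2))) with hd
  have hd0 : ∀ x, 0 ≤ d x := arcDensity_nonneg hnn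
  refine ⟨4 * K, fun h hh => ?_⟩
  set f : ℝ → ℝ := fun y => log |(r + h) - y| + log |(r - h) - y| - 2 * log |r - y| with hf
  have i1 := integrable_log_critical hV hsymm hconv hr hS (r + h)
  have i2 := integrable_log_critical hV hsymm hconv hr hS (r - h)
  have i3 := integrable_log_critical hV hsymm hconv hr hS r
  have hfi : Integrable f ρ := by
    refine ((i1.add i2).neg.add (i3.const_mul 2)).congr (Eventually.of_forall fun y => ?_)
    simp only [hf, Pi.add_apply, Pi.neg_apply]; ring
  have hint : ∫ y, -log |(r + h) - y| ∂ρ + ∫ y, -log |(r - h) - y| ∂ρ - 2 * ∫ y, -log |r - y| ∂ρ =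
      -∫ y, f y ∂ρ := by
    rw [← integral_const_mul, ← integral_add i1 i2, ← integral_sub _ (i3.const_mul 2),
      ← integral_neg]
    · refine integral_congr_ae (Eventually.of_forall fun y => ?_)
      simp only [hf]; ring
    · exact i1.add i2
  rw [hint]
  refine neg_le_neg ?_
  have hdm : Measurable fun x => ENNReal.ofReal (d x) := (measurable_arcDensity hG).ennreal_ofReal
  have hρd : ρ = volume.withDensity fun x => ENNReal.ofReal (d x) := rfl
  rw [hρd] at hfi ⊢
  rw [integrable_withDensity_iff_integrable_smul' hdm (by simp)] at hfi
  rw [integral_withDensity_eq_integral_toReal_smul hdm (by simp)]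
  have hind : Integrable ((Ioo (r - h) r).indicator fun _ => 4 * K * √h) := by
    rw [integrable_indicator_iff measurableSet_Ioo]
    exact integrableOn_const (by simp)
  have hle : ∫ y, (ENNReal.ofReal (d y)).toReal • f y ≤
      ∫ y, (Ioo (r - h) r).indicator (fun _ => 4 * K * √h) y := by
    refine integral_mono_ae hfi hind ?_
    -- At y = r - h the convention log 0 = 0 applies and the pointwise bound is not available.
    have n1 : ∀ᵐ y : ℝ, y ≠ r - h := by simp [ae_iff]
    filter_upwards [n1] with y hy
    simp only [ENNReal.toReal_ofReal (hd0 y), smul_eq_mul]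
    by_cases hyr : y ∈ Ioo (-r) r
    · have hs : 0 < r - y := by linarith [hyr.2]
      have hb := log_second_difference_le hs hh (fun e => hy (by linarith))
      have hfy : f y ≤ if r - y < h then 4 * √h / √(r - y) else 0 := by
        refine le_trans (le_of_eq ?_) hb
        rw [hf]
        simp only
        rw [abs_of_pos hs, show r + h - y = r - y + h by ring, show r - h - y = r - y - h by ring,
          abs_of_pos (show 0 < r - y + h by linarith)]
      refine (mul_le_mul_of_nonneg_left hfy (hd0 y)).trans ?_
      split_ifs with hlt
      · rw [indicator_of_mem (show y ∈ Ioo (r - h) r from ⟨by linarith, hyr.2⟩)]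
        have hsq : 0 < √(r - y) := sqrt_pos.2 hs
        calc d y * (4 * √h / √(r - y)) ≤ K * √(r - y) * (4 * √h / √(r - y)) := by
              gcongr; exact hK y
          _ = 4 * K * √h := by field_simp
      · rw [mul_zero]
        exact indicator_nonneg (fun _ _ => by positivity) y
    · rw [hd, indicator_of_notMem hyr, zero_mul]
      exact indicator_nonneg (fun _ _ => by positivity) y
  refine hle.trans (le_of_eq ?_)
  rw [integral_indicator measurableSet_Ioo]
  simp [hh.le]
  ring

/-- The effective potential of the critical measure. -/
lemma effective_potential_ge {z : ℝ} (hz : r < z) :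
    log 2 - log r + chebCoeff V r 0 ≤
      V z + ∫ y, -log |z - y| ∂(arcMeasure (pushedDensity V r) r) := by
  have hnn := pushedDensity_critical_nonneg hV hconv hr hS
  obtain ⟨K, hK⟩ := exists_second_difference_potential_le hV hsymm hconv hr hS
  have hpot := fun x hx => (potential_pushed hV hsymm hr hnn (x := x) hx).2
  have hprob := isProbabilityMeasure_pushed hV hsymm hr hnn
  have hint := integrable_log_critical hV hsymm hconv hr hS
  set C := log 2 - log r + chebCoeff V r 0
  set ρ := arcMeasure (pushedDensity V r) r with hρ
  set u : ℝ → ℝ := fun x => ∫ y, -log |x - y| ∂ρ with hu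
  have hΨr : V r + u r = C := hpot r ⟨by linarith, le_rfl⟩
  have hlt : ∀ᵐ y ∂ρ, y < r := by
    have h1 : ∀ᵐ y ∂ρ, y ∈ Icc (-r) r := mem_ae_iff.2 arcMeasure_compl
    have h2 : ∀ᵐ y ∂ρ, y ≠ r := by simp [ae_iff, hρ]
    filter_upwards [h1, h2] with y h h' using lt_of_le_of_ne h.2 h'
  -- Let Ψ = V + u and t = h / (z - r). Convexity on the chord from r to z gives Ψ(r + h) ≤ (1 - t)
  -- C + t Ψ(z); the second difference with Ψ(r - h) = Ψ(r) = C gives Ψ(r + h) ≥ C - K h √h.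
  -- Dividing by t leaves an error K (z - r) √h, which vanishes as h ↓ 0. The bound h < r keeps r -
  -- h in the interval.
  have key : ∀ h ∈ Ioo 0 (min (z - r) r), C - K * (z - r) * √h ≤ V z + u z := by
    intro h ⟨hh, hh'⟩
    have hhz : h < z - r := lt_of_lt_of_le hh' (min_le_left _ _)
    have hhr : h < r := lt_of_lt_of_le hh' (min_le_right _ _)
    have hsd := hK h hh
    have hΨm : V (r - h) + u (r - h) = C := hpot (r - h) ⟨by linarith, by linarith⟩
    set t := h / (z - r) with ht
    have hzr : 0 < z - r := by linarith
    have ht0 : 0 < t := div_pos hh hzr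
    have ht1 : t ≤ 1 := by rw [ht, div_le_one hzr]; exact hhz.le
    have hth : t * (z - r) = h := by rw [ht]; field_simp
    have hcomb : (1 - t) * r + t * z = r + h := by linear_combination hth
    have hVmid : 2 * V r ≤ V (r + h) + V (r - h) := by
      have := hconv.convexOn.2 (mem_univ (r + h)) (mem_univ (r - h))
        (show (0 : ℝ) ≤ 1 / 2 by norm_num) (show (0 : ℝ) ≤ 1 / 2 by norm_num) (by norm_num)
      simp only [smul_eq_mul] at this
      rw [show 1 / 2 * (r + h) + 1 / 2 * (r - h) = r by ring] at this
      linarith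
    have hVc : V (r + h) ≤ (1 - t) * V r + t * V z := by
      have := hconv.convexOn.2 (mem_univ r) (mem_univ z) (show 0 ≤ 1 - t by linarith) ht0.le
        (by ring)
      simpa only [smul_eq_mul, hcomb] using this
    have huc : u (r + h) ≤ (1 - t) * u r + t * u z := by
      rw [hu]
      simp only
      rw [← integral_const_mul, ← integral_const_mul, ← integral_add ((hint r).const_mul _)
        ((hint z).const_mul _)]
      refine integral_mono_ae (hint _) (((hint r).const_mul _).add ((hint z).const_mul _)) ?_
      filter_upwards [hlt] with y hy
      have := strictConcaveOn_log_Ioi.concaveOn.2 (show r - y ∈ Ioi 0 from sub_pos.2 hy)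
        (show z - y ∈ Ioi 0 from sub_pos.2 (hy.trans hz)) (show 0 ≤ 1 - t by linarith) ht0.le
        (by ring)
      simp only [smul_eq_mul] at this
      rw [show (1 - t) * (r - y) + t * (z - y) = r + h - y by linear_combination hth] at this
      rw [abs_of_pos (sub_pos.2 hy), abs_of_pos (sub_pos.2 (hy.trans hz)),
        abs_of_pos (show 0 < r + h - y by linarith)]
      linarith
    have h1 : -(K * (h * √h)) ≤ u (r + h) + u (r - h) - 2 * u r := hsd
    have h2 : t * (C - K * (z - r) * √h) ≤ t * (V z + u z) := by
      have e : t * (K * (z - r) * √h) = K * (h * √h) := by rw [← hth]; ring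
      have e2 : (1 - t) * (V r + u r) = (1 - t) * C := by rw [hΨr]
      have : t * (C - K * (z - r) * √h) = t * C - K * (h * √h) := by rw [mul_sub, e]
      rw [this]
      linarith
    exact le_of_mul_le_mul_left h2 ht0
  have hcont : ContinuousAt (fun h : ℝ => C - K * (z - r) * √h) 0 :=
    Continuous.continuousAt (by fun_prop)
  have hl := hcont.tendsto.mono_left (nhdsWithin_le_nhds (s := Ioi 0))
  simp only [sqrt_zero, mul_zero, sub_zero] at hl
  refine le_of_tendsto hl ?_
  filter_upwards [Ioo_mem_nhdsGT (show (0 : ℝ) < min (z - r) r from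
    lt_min (sub_pos.2 hz) hr)] with h hh using key h hh

lemma potential_neg (x : ℝ) :
    ∫ y, -log |-x - y| ∂(arcMeasure (pushedDensity V r) r) =
      ∫ y, -log |x - y| ∂(arcMeasure (pushedDensity V r) r) := by
  have hnn := pushedDensity_critical_nonneg hV hconv hr hS
  have hG := continuous_pushedDensity hV r
  rw [integral_arcMeasure hG hnn hr, integral_arcMeasure hG hnn hr, ← integral_comp_neg_cos
    (fun z => pushedDensity V r (r * z) * -log |x - r * z|)]
  congr 1
  refine intervalIntegral.integral_congr fun θ _ => ?_
  simp only [mul_neg, pushedDensity_neg hsymm]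
  rw [← abs_neg (-x - r * cos θ)]
  ring_nf

/-- The pulled phase. -/
lemma isEquilibrium_pulled {R : ℝ} (hR : r ≤ R) :
    IsEquilibrium V (Icc (-R) R) (arcMeasure (pushedDensity V r) r) ∧
    ∀ μ, IsEquilibrium V (Icc (-R) R) μ → μ = arcMeasure (pushedDensity V r) r := by
  have hnn := pushedDensity_critical_nonneg hV hconv hr hS
  have hprob := isProbabilityMeasure_pushed hV hsymm hr hnn
  have hcompl : arcMeasure (pushedDensity V r) r (Icc (-R) R)ᶜ = 0 :=
    measure_mono_null (compl_subset_compl.2 (Icc_subset_Icc (by linarith) hR)) arcMeasure_compl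
  refine isEquilibrium_of_potential (hr.trans_le hR) hcompl hV.continuous
    (integrable_neg_log_pushed hV hsymm hr hnn) (C := log 2 - log r + chebCoeff V r 0)
    (fun x hx => ?_) ?_
  · by_cases hx1 : r < x
    · exact effective_potential_ge hV hsymm hconv hr hS hx1
    by_cases hx2 : x < -r
    · have := effective_potential_ge hV hsymm hconv hr hS (show r < -x by linarith)
      rwa [hsymm, potential_neg hV hsymm hconv hr hS] at this
    · exact (potential_pushed hV hsymm hr hnn ⟨not_lt.1 hx2, not_lt.1 hx1⟩).2.ge
  · filter_upwards [show ∀ᵐ x ∂(arcMeasure (pushedDensity V r) r), x ∈ Icc (-r) r from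
      mem_ae_iff.2 arcMeasure_compl] with x hx using (potential_pushed hV hsymm hr hnn hx).2

lemma energy_critical_eq_coe : ∃ e : ℝ, energy V (arcMeasure (pushedDensity V r) r) = e := by
  have hnn := pushedDensity_critical_nonneg hV hconv hr hS
  have hprob := isProbabilityMeasure_pushed hV hsymm hr hnn
  exact ⟨_, energy_eq_integral prod_diag_eq_zero
    ((integrable_pairEnergy_iff arcMeasure_compl hV.continuous).2
      (integrable_neg_log_pushed hV hsymm hr hnn))⟩

end

lemma pulledMeasure_meanSlope {V : ℝ → ℝ} {r : ℝ} (hS : meanVirial V r = 1) :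
    pulledMeasure (meanSlope V r) r = arcMeasure (pushedDensity V r) r := by
  rw [pulledMeasure_eq_arcMeasure]
  congr 1
  ext x
  rw [pushedDensity_critical hS]

end LogGas

/-! ### The theorem -/

theorem theorem1 (V : ℝ → ℝ)
    (hV : ContDiff ℝ 3 V)
    (hsymm : ∀ x, V (-x) = V x)
    (hconv : StrictConvexOn ℝ Set.univ V)
    (hlog : 1 < Filter.liminf (fun x : ℝ => ((V x / Real.log |x| : ℝ) : EReal))
      (Filter.cocompact ℝ)) :
    -- the series that occur in the statement converge absolutely
    (∀ R : ℝ, 0 < R →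
      Summable (fun n : ℕ => (n : ℝ) * LogGas.chebCoeff V R n) ∧
      ∀ x ∈ Set.Icc (-R) R,
        Summable (fun n : ℕ => (n : ℝ) * LogGas.chebCoeff V R n * LogGas.chebT n (x / R))) ∧
    ∃ (Rstar : ℝ) (Q : ℝ → ℝ),
      -- the critical radius
      IsLeast {R : ℝ | 0 < R ∧ HasSum (fun n : ℕ => (n : ℝ) * LogGas.chebCoeff V R n) 1} Rstar ∧
      -- the function `Q`, extended by continuity to the end points, and the signs of `P_R` and `Q`
      (∀ x ∈ Set.Ioo (-Rstar) Rstar,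
        Filter.Tendsto (fun R : ℝ => LogGas.pushedP V R x / (R ^ 2 - x ^ 2))
          (nhdsWithin Rstar (Set.Iio Rstar)) (nhds (Q x))) ∧
      ContinuousOn Q (Set.Icc (-Rstar) Rstar) ∧
      (∀ x ∈ Set.Icc (-Rstar) Rstar, 0 ≤ Q x) ∧
      (∀ R : ℝ, 0 < R → R < Rstar → ∀ x ∈ Set.Icc (-R) R, 0 ≤ LogGas.pushedP V R x) ∧
      -- the constrained minimiser: existence, uniqueness, support, and density in both phases
      (∀ R : ℝ, 0 < R →
        (∃! ρ : MeasureTheory.Measure ℝ, LogGas.IsEquilibrium V (Set.Icc (-R) R) ρ) ∧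
        ∀ ρ : MeasureTheory.Measure ℝ, LogGas.IsEquilibrium V (Set.Icc (-R) R) ρ →
          (R < Rstar →
            ρ = LogGas.pushedMeasure V R ∧ ρ.support = Set.Icc (-R) R) ∧
          (Rstar ≤ R →
            ρ = LogGas.pulledMeasure Q Rstar ∧ ρ.support = Set.Icc (-Rstar) Rstar)) ∧
      -- `Rstar` is the radius of the gas at equilibrium without walls
      LogGas.IsEquilibrium V Set.univ (LogGas.pulledMeasure Q Rstar) := by
  have hsum := fun {R : ℝ} (hR : 0 < R) => LogGas.hasSum_nat_mul_chebCoeff_one hV hsymm hR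
  obtain ⟨r, ⟨⟨hr, hS⟩, hmin⟩, hlt⟩ := LogGas.exists_critical_radius hV hconv hsymm
  have hpos : ∀ R : ℝ, 0 < R → R < r → ∀ x ∈ Set.Icc (-R) R, 0 < LogGas.pushedDensity V R x := by
    intro R hR hRr x hx
    have h1 := hlt R hR hRr
    have h2 := (LogGas.meanSlope_pos hV hconv hR x).le
    have h3 : 0 ≤ R ^ 2 - x ^ 2 := by nlinarith [hx.1, hx.2]
    have := mul_nonneg h3 h2
    rw [LogGas.pushedDensity]
    linarith
  have hpull := LogGas.pulledMeasure_meanSlope hS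
  refine ⟨fun R hR => ⟨(hsum hR).summable, fun x hx =>
    (LogGas.hasSum_nat_mul_chebCoeff hV hsymm hR hx).summable⟩, r, LogGas.meanSlope V r,
    ⟨⟨hr, hS ▸ hsum hr⟩, fun R hR => hmin ⟨hR.1, (hsum hR.1).unique hR.2⟩⟩, fun x hx => ?_,
    (LogGas.continuous_meanSlope hV r).continuousOn,
    fun x _ => (LogGas.meanSlope_pos hV hconv hr x).le, fun R hR hRr x hx => ?_,
    fun R hR => ?_, ?_⟩
  -- For |x| < R the quotient is (1 - S(R)) / (R² - x²) + m_R(x), continuous in R at r, where its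
  -- first term vanishes.
  · have hd : 0 < r ^ 2 - x ^ 2 := by nlinarith [hx.1, hx.2]
    have c0 : ContinuousAt (fun R : ℝ => R ^ 2 - x ^ 2) r := by fun_prop
    have c1 : ContinuousAt (fun R => (1 - LogGas.meanVirial V R) / (R ^ 2 - x ^ 2)) r :=
      (continuousAt_const.sub (LogGas.continuous_meanVirial hV).continuousAt).div c0 hd.ne'
    have c2 : ContinuousAt (fun R => LogGas.meanSlope V R x) r :=
      ((LogGas.continuous_meanSlope_uncurry hV).comp
        (by fun_prop : Continuous fun R : ℝ => (R, x))).continuousAt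
    have ht : Filter.Tendsto
        (fun R => (1 - LogGas.meanVirial V R) / (R ^ 2 - x ^ 2) + LogGas.meanSlope V R x)
        (nhdsWithin r (Set.Iio r))
        (nhds ((1 - LogGas.meanVirial V r) / (r ^ 2 - x ^ 2) + LogGas.meanSlope V r x)) :=
      (c1.add c2).tendsto.mono_left nhdsWithin_le_nhds
    rw [hS, sub_self, zero_div, zero_add] at ht
    refine ht.congr' ?_
    have hx' : |x| < r := abs_lt.2 hx
    filter_upwards [Ioo_mem_nhdsLT hx'] with R hR
    have hR0 : 0 < R := (abs_nonneg x).trans_lt hR.1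
    have hxR := abs_lt.1 hR.1
    have hdR : R ^ 2 - x ^ 2 ≠ 0 := by
      have : 0 < R ^ 2 - x ^ 2 := by nlinarith [hxR.1, hxR.2]
      exact this.ne'
    rw [LogGas.pushedP_eq hV hsymm hR0 ⟨hxR.1.le, hxR.2.le⟩]
    field_simp
  · rw [LogGas.pushedP_eq hV hsymm hR hx]
    exact (hpos R hR hRr x hx).le
  · rcases lt_or_ge R r with hRr | hRr
    · obtain ⟨h1, h2⟩ := LogGas.isEquilibrium_pushed hV hsymm hR fun x hx => (hpos R hR hRr x hx).le
      refine ⟨⟨_, h1, h2⟩, fun ρ hρ => ⟨fun _ => ?_, fun h => absurd hRr h.not_gt⟩⟩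
      rw [h2 ρ hρ, LogGas.pushedMeasure_eq_arcMeasure hV hsymm hR]
      exact ⟨rfl, LogGas.support_arcMeasure (LogGas.continuous_pushedDensity hV R) hR
        fun x hx => hpos R hR hRr x (Set.Ioo_subset_Icc_self hx)⟩
    · obtain ⟨h1, h2⟩ := LogGas.isEquilibrium_pulled hV hsymm hconv hr hS hRr
      refine ⟨⟨_, h1, h2⟩, fun ρ hρ => ⟨fun h => absurd h hRr.not_gt, fun _ => ?_⟩⟩
      rw [h2 ρ hρ, hpull]
      -- At the critical radius the density is positive only on the open interval, which is still
      -- enough for the support.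
      refine ⟨rfl, LogGas.support_arcMeasure (LogGas.continuous_pushedDensity hV r) hr fun x hx => ?_⟩
      rw [LogGas.pushedDensity_critical hS]
      exact mul_pos (by nlinarith [hx.1, hx.2]) (LogGas.meanSlope_pos hV hconv hr x)
  · rw [hpull]
    obtain ⟨e, he⟩ := LogGas.energy_critical_eq_coe hV hsymm hconv hr hS
    obtain ⟨M, hM⟩ := LogGas.exists_le_pairEnergy hV hconv hsymm
    exact LogGas.isEquilibrium_univ hV.continuous he
      (fun R hR _ => (LogGas.isEquilibrium_pulled hV hsymm hconv hr hS hR).1) hM
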